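/- Let $n\ge 1$, $m\ge 0$, and let $V\subset\mathbb R^{n}\times\mathbb R^{m}$ (the coordinate image of a fibered chart domain of a fibered manifold with $n$-dimensional base, with coordinates $(x^i,y^\sigma)$) be open and vertically star-shaped: $(x,y)\in V$, $t\in[0,1]$ imply $(x,ty)\in V$. Let $\pi(V)\subset\mathbb R^n$ be its projection and let $V^r$ be the part of the $r$-jet space over $V$, with coordinates $(x^i,y^\sigma,y^\sigma_{i},\dots,y^\sigma_{i_1\dots i_r})$ (symmetric in the lower indices) and projections $\pi^{s,r}:V^s\to V^r$, $\pi^r:V^r\to\pi(V)$. Summation over repeated indices is understood, $\partial/\partial y^\sigma_{ij}$ denotes the symmetrized derivative, and $d_i$ is the total derivative. Put $\omega_0=dx^1\wedge\dots\wedge dx^n$, $\omega_i=\mathbf i_{\partial_i}\omega_0$, $\omega_{ij}=\mathbf i_{\partial_j}\omega_i$ (zero if $n=1$), $\omega^\sigma=dy^\sigma-y^\sigma_jdx^j$, $\omega^\sigma_j=dy^\sigma_j-y^\sigma_{jk}dx^k$. For a form $\rho$ on $V^r$, let $p_1\rho$ be the component of $(\pi^{r+1,r})^*\rho$ with exactly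 one contact factor. For a first order Lagrangian $\lambda=\mathcal L\,\omega_0$ let $$\Theta_\lambda=\mathcal L\omega_0+\frac{\partial\mathcal L}{\partial y^\sigma_i}\omega^\sigma\wedge\omega_i ,\qquad \mathcal E_\lambda=\Big(\frac{\partial\mathcal L}{\partial y^\sigma}-d_i\frac{\partial\mathcal L}{\partial y^\sigma_i}\Big)\omega^\sigma\wedge\omega_0,$$ and for a second order Lagrangian $\lambda=\mathcal L\,\omega_0$ let $$\Theta_\lambda=\mathcal L\omega_0+\Big(\frac{\partial\mathcal L}{\partial y^\sigma_i}-d_j\frac{\partial\mathcal L}{\partial y^\sigma_{ij}}\Big)\omega^\sigma\wedge\omega_i+\frac{\partial\mathcal L}{\partial y^\sigma_{ij}}\omega^\sigma_j\wedge\omega_i .$$ Let $I$ be the fibered homotopy operator $I\rho=\int_0^1\rho^{(0)}(t)\,dt$, where $\chi^*\rho=dt\wedge\rho^{(0)}(t)+\rho'(t)$ (with $\rho'(t)$ free of $dt$) for the scaling $\chi(t,\cdot)$ that multiplies all coordinates $y^\sigma,y^\sigma_i,\dots$ by $t$ and fixes the $x^i$. Let $\lambda$ be a smooth $\pi^1$-horizontal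 $n$-form (a first order Lagrangian) on $V^1$, and $\lambda_{VT}=I\mathcal E_\lambda$ its Vainberg–Tonti Lagrangian, a horizontal $n$-form on $V^2$. Then there is a smooth $(n-1)$-form $\mu_0$ on $\pi(V)$ with $d\mu_0=0^*\Theta_\lambda$, where $0$ is the zero section. For every such $\mu_0$, put $\alpha=I\Theta_\lambda+(\pi^1)^*\mu_0$. Then: (i) $\alpha=\alpha^i\omega_i$ with smooth functions $\alpha^i=\alpha^i(x^j,y^\sigma,y^\sigma_j)$ on $V^1$, and on $V^2$ $$(\pi^{2,1})^*\lambda=\lambda_{VT}+(d_i\alpha^i)\,\omega_0 .$$ (ii) The canonical Lepage equivalent $\Phi_\lambda=\Theta_{\lambda_{VT}}+d\alpha$ is of second order: there is a smooth form $\Phi_\lambda$ on $V^2$ whose pullback to $V^3$ is $\Theta_{\lambda_{VT}}+(\pi^{3,1})^*d\alpha$, and every such form satisfies, on $V^2$, $$\Phi_\lambda=(\pi^{2,1})^*\Theta_\lambda+p_1d\nu,\qquad \nu=\frac14\Big(\frac{\partial\alpha^j}{\partial y^\sigma_i}-\frac{\partial\alpha^i}{\partial y^\sigma_j}\Big)\omega^\sigma\wedge\omega_{ij}.$$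 -/

import Mathlib

open scoped ContDiff

noncomputable section

namespace Lepage

/-! ### Jet spaces in a fibered chart

`n` is the dimension of the base, `m` the dimension of the fibres. A chart on the `r`-jet
prolongation has the coordinates `x^i` and `y^σ_J`, where `J` runs over the (unordered)
multi-indices `J = j_1 ... j_k` of length `k ≤ r` with entries in `{1, ..., n}`. -/

/-- Unordered multi-indices `j_1 ... j_k` of length `k ≤ r`. -/
abbrev MultiIdx (n r : ℕ) : Type := {J : Multiset (Fin n) // J.card ≤ r}

instance (n r : ℕ) : Fintype (MultiIdx n r) :=
  Fintype.ofInjective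
    (fun J : MultiIdx n r => fun i : Fin n =>
      (⟨J.1.count i, Nat.lt_succ_of_le ((Multiset.count_le_card i J.1).trans J.2)⟩ : Fin (r + 1)))
    (by
      intro J K h
      apply Subtype.ext
      ext i
      exact congrArg Fin.val (congrFun h i))

/-- The coordinate space of `r`-jets: the points `(x^i, y^σ_J)` with `|J| ≤ r`. -/
abbrev Jet (n m r : ℕ) : Type := (Fin n → ℝ) × (Fin m → MultiIdx n r → ℝ)

/-- A differential `k`-form on (an open part of) a normed space `E`. -/
abbrev Form (E : Type) [NormedAddCommGroup E] [NormedSpace ℝ E] (k : ℕ) : Type :=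
  E → E [⋀^Fin k]→L[ℝ] ℝ

/-- The part `V^r` of the `r`-jet space which lies over `V`, where `V` is a set of points
`(x^i, y^σ)`. -/
def jetSet {n m : ℕ} (V : Set ((Fin n → ℝ) × (Fin m → ℝ))) (r : ℕ) : Set (Jet n m r) :=
  {z | (z.1, fun σ => z.2 σ ⟨0, Nat.zero_le r⟩) ∈ V}

/-- `V` is vertically star-shaped: it contains with `(x, y)` all points `(x, t y)`,
`t ∈ [0, 1]`. -/
def VerticallyStarShaped {n m : ℕ} (V : Set ((Fin n → ℝ) × (Fin m → ℝ))) : Prop :=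
  ∀ p ∈ V, ∀ t ∈ Set.Icc (0 : ℝ) 1, (p.1, t • p.2) ∈ V

variable {n m r s k : ℕ}

/-- The jet projection `π^{r,s}`, for `s ≤ r`. -/
def jetProj (h : s ≤ r) : Jet n m r →L[ℝ] Jet n m s where
  toFun z := (z.1, fun σ J => z.2 σ ⟨J.1, J.2.trans h⟩)
  map_add' _ _ := rfl
  map_smul' _ _ := rfl
  cont := by fun_prop

/-- The projection `π^r` to the base. -/
def baseProj : Jet n m r →L[ℝ] (Fin n → ℝ) := ContinuousLinearMap.fst ℝ _ _

/-- The zero section `x ↦ (x, 0, ..., 0)` of the `r`-jet space. -/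
def zeroSection : (Fin n → ℝ) →L[ℝ] Jet n m r := ContinuousLinearMap.inl ℝ _ _

/-- The pullback of a form along a linear map. All maps along which forms are pulled back below
(projections, zero section) are linear in the chosen coordinates. -/
def pull {E F : Type} [NormedAddCommGroup E] [NormedSpace ℝ E] [NormedAddCommGroup F]
    [NormedSpace ℝ F] (f : E →L[ℝ] F) (ρ : Form F k) : Form E k :=
  fun z => (ρ (f z)).compContinuousLinearMap f

/-! ### Coordinate vector fields and derivatives -/

/-- The coordinate vector `∂_i = ∂/∂x^i`. -/
def dX (i : Fin n) : Jet n m r := (Pi.single i 1, 0)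

/-- The coordinate vector in the direction of the coordinate `y^σ_J`. -/
def dY (σ : Fin m) (J : MultiIdx n r) : Jet n m r := (0, Pi.single σ (Pi.single J 1))

/-- `∂f/∂y^σ` for a function on the `r`-jet space. -/
def pderiv0 (σ : Fin m) (f : Jet n m r → ℝ) (z : Jet n m r) : ℝ :=
  fderiv ℝ f z (dY σ ⟨0, Nat.zero_le r⟩)

/-- `∂f/∂y^σ_i`, for a function on a jet space of order at least one. -/
def pderiv1 (σ : Fin m) (i : Fin n) (f : Jet n m (r + 1) → ℝ) (z : Jet n m (r + 1)) : ℝ :=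
  fderiv ℝ f z (dY σ ⟨{i}, by simp⟩)

/-- `∂f/∂y^σ_{ij}`, for a function on a jet space of order at least two. As usual, it is understood
as the derivative in the symmetrized direction, i.e.,
`∂y^τ_{kl}/∂y^σ_{ij} = (δ^i_k δ^j_l + δ^i_l δ^j_k) δ^τ_σ / 2`; so for `i ≠ j` it is one half of the
derivative with respect to the single independent coordinate `y^σ_{ij} = y^σ_{ji}`. -/
def pderiv2 (σ : Fin m) (i j : Fin n) (f : Jet n m (r + 2) → ℝ) (z : Jet n m (r + 2)) : ℝ :=
  (if i = j then 1 else 1 / 2) * fderiv ℝ f z (dY σ ⟨{i, j}, by simp⟩)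

/-- The vector `∂_i + y^σ_{J i} ∂/∂y^σ_J` (sum over the independent coordinates, `|J| ≤ r`), which
depends on a point of the `(r+1)`-jet space. -/
def totalVec (i : Fin n) (z : Jet n m (r + 1)) : Jet n m r :=
  (Pi.single i 1, fun σ J => z.2 σ ⟨i ::ₘ J.1, by simpa using J.2⟩)

/-- The total derivative `d_i f` of a function on the `r`-jet space,
`d_i f = ∂_i f + (∂f/∂y^σ) y^σ_i + ...`, a function on the `(r+1)`-jet space. -/
def totalDeriv (i : Fin n) (f : Jet n m r → ℝ) (z : Jet n m (r + 1)) : ℝ :=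
  fderiv ℝ f (jetProj r.le_succ z) (totalVec i z)

/-! ### Horizontal and contact parts -/

/-- The coordinate form `dx^i`. -/
def dxForm (i : Fin n) : Jet n m r →L[ℝ] ℝ := (ContinuousLinearMap.proj i).comp baseProj

/-- The horizontal part `dx^i ⊗ (∂_i + y^σ_{J i} ∂/∂y^σ_J)` of the tangent map of `π^{r+1,r}`
at `z`. -/
def horPart (z : Jet n m (r + 1)) : Jet n m (r + 1) →L[ℝ] Jet n m r :=
  ∑ i, (dxForm i).smulRight (totalVec i z)

/-- The contact part of the tangent map of `π^{r+1,r}` at `z`. -/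
def contactPart (z : Jet n m (r + 1)) : Jet n m (r + 1) →L[ℝ] Jet n m r :=
  jetProj r.le_succ - horPart z

/-- The 1-contact component `p_1 ρ` of the pullback of `ρ` to the `(r+1)`-jet space. Inserting
`Tπ = H + P` (horizontal plus contact part) in each argument of `ρ` and expanding, `p_1 ρ` collects
the terms with exactly one `P`; see `p1_apply`. -/
def p1 (ρ : Form (Jet n m r) k) : Form (Jet n m (r + 1)) k :=
  fun z => (ρ (jetProj r.le_succ z)).fderivCompContinuousLinearMap (horPart z) (contactPart z)

theorem p1_apply (ρ : Form (Jet n m r) k) (z : Jet n m (r + 1)) (v : Fin k → Jet n m (r + 1)) :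
    p1 ρ z v = ∑ i, ρ (jetProj r.le_succ z)
      (fun j => if j = i then contactPart z (v j) else horPart z (v j)) := by
  simp only [p1, ContinuousAlternatingMap.fderivCompContinuousLinearMap_apply]
  refine Finset.sum_congr rfl fun i _ => congrArg _ (funext fun j => ?_)
  by_cases h : j = i
  · subst h; simp
  · simp [h]

/-! ### The forms `ω_0`, `ω_i`, `ω^σ ∧ ω_{ij}` and the contact forms -/

/-- The form `dx^1 ∧ ... ∧ dx^n` on the base. -/
def baseVol (n : ℕ) : (Fin n → ℝ) [⋀^Fin n]→L[ℝ] ℝ :=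
  { (Matrix.detRowAlternating : (Fin n → ℝ) [⋀^Fin n]→ₗ[ℝ] ℝ) with
    cont := Continuous.matrix_det continuous_id }

/-- `ω_0 = dx^1 ∧ ... ∧ dx^n` on the jet space. -/
def omega0 : Jet n m r [⋀^Fin n]→L[ℝ] ℝ := (baseVol n).compContinuousLinearMap baseProj

/-- `ω_i`, the interior product of `∂_i` and `ω_0`. -/
def omega1 (i : Fin (n + 1)) : Jet (n + 1) m r [⋀^Fin n]→L[ℝ] ℝ := omega0.curryLeft (dX i)

/-- The exterior product `θ ∧ η` of a 1-form `θ` with a `k`-form `η`: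
`(θ ∧ η)(v_0, ..., v_k) = ∑ i, (-1)^i θ(v_i) η(v_0, .., v_{i-1}, v_{i+1}, .., v_k)`. -/
def wedge {E : Type} [NormedAddCommGroup E] [NormedSpace ℝ E] (θ : E →L[ℝ] ℝ)
    (η : E [⋀^Fin k]→L[ℝ] ℝ) : E [⋀^Fin (k + 1)]→L[ℝ] ℝ :=
  ContinuousAlternatingMap.alternatizeUncurryFin (θ.smulRight η)

/-- `θ ∧ i_X η` for a 1-form `θ`, a vector `X` and a `k`-form `η`; it is zero for `k = 0`, since the
interior product of a vector with a 0-form is zero. -/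
def wedgeInterior {E : Type} [NormedAddCommGroup E] [NormedSpace ℝ E] (θ : E →L[ℝ] ℝ) (X : E) :
    {k : ℕ} → E [⋀^Fin k]→L[ℝ] ℝ → E [⋀^Fin k]→L[ℝ] ℝ
  | 0, _ => 0
  | _ + 1, η => wedge θ (η.curryLeft X)

/-- The coordinate form `dy^σ_J`. -/
def dyForm (σ : Fin m) (J : MultiIdx n r) : Jet n m r →L[ℝ] ℝ where
  toFun v := v.2 σ J
  map_add' _ _ := rfl
  map_smul' _ _ := rfl
  cont := by fun_prop

/-- The contact form `ω^σ_J = dy^σ_J - y^σ_{J j} dx^j` at a point `z` of the `r`-jet space,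
`|J| < r`. -/
def contactForm (σ : Fin m) (J : Multiset (Fin n)) (hJ : J.card + 1 ≤ r) (z : Jet n m r) :
    Jet n m r →L[ℝ] ℝ :=
  dyForm σ ⟨J, (Nat.le_succ _).trans hJ⟩
    - ∑ j, z.2 σ ⟨j ::ₘ J, by simpa using hJ⟩ • dxForm j

/-- `ω^σ` on a jet space of order at least one. -/
def contact0 (σ : Fin m) (z : Jet n m (r + 1)) : Jet n m (r + 1) →L[ℝ] ℝ :=
  contactForm σ 0 (by simp) z

/-- `ω^σ_j` on a jet space of order at least two. -/
def contact1 (σ : Fin m) (j : Fin n) (z : Jet n m (r + 2)) : Jet n m (r + 2) →L[ℝ] ℝ :=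
  contactForm σ {j} (by simp) z

/-! ### Lagrangians, Euler-Lagrange forms, principal Lepage equivalents -/

/-- A form is `π^r`-horizontal over `V` if it vanishes whenever one argument is
`π^r`-vertical. -/
def IsHorizontal (V : Set ((Fin n → ℝ) × (Fin m → ℝ))) (ρ : Form (Jet n m r) k) : Prop :=
  ∀ z ∈ jetSet V r, ∀ v : Fin k → Jet n m r, (∃ i, baseProj (v i) = 0) → ρ z v = 0

/-- The Lagrange function `L` of a Lagrangian `L ω_0`. -/
def lagrangeFun (lam : Form (Jet n m r) n) (z : Jet n m r) : ℝ := lam z fun i => dX i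

/-- The Euler-Lagrange expressions `E_σ = ∂L/∂y^σ - d_i (∂L/∂y^σ_i)` of a first order
Lagrangian. -/
def eulerLagrange (lam : Form (Jet n m 1) n) (σ : Fin m) (z : Jet n m 2) : ℝ :=
  pderiv0 σ (lagrangeFun lam) (jetProj (by norm_num) z)
    - ∑ i, totalDeriv i (pderiv1 σ i (lagrangeFun lam)) z

/-- The Euler-Lagrange form `E_σ ω^σ ∧ ω_0` of a first order Lagrangian. -/
def eulerLagrangeForm (lam : Form (Jet n m 1) n) : Form (Jet n m 2) (n + 1) :=
  fun z => ∑ σ, eulerLagrange lam σ z • wedge (contact0 σ z) omega0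

/-- The principal Lepage equivalent `L ω_0 + (∂L/∂y^σ_i) ω^σ ∧ ω_i` of a first order
Lagrangian. -/
def Theta1 (lam : Form (Jet (n + 1) m 1) (n + 1)) : Form (Jet (n + 1) m 1) (n + 1) :=
  fun z => lagrangeFun lam z • omega0
    + ∑ σ, ∑ i, pderiv1 σ i (lagrangeFun lam) z • wedge (contact0 σ z) (omega1 i)

/-- The principal Lepage equivalent
`L ω_0 + (∂L/∂y^σ_i - d_j (∂L/∂y^σ_{ij})) ω^σ ∧ ω_i + (∂L/∂y^σ_{ij}) ω^σ_j ∧ ω_i`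
of a second order Lagrangian, a form on the 3-jet space. -/
def Theta2 (lam : Form (Jet (n + 1) m 2) (n + 1)) : Form (Jet (n + 1) m 3) (n + 1) :=
  fun z => lagrangeFun lam (jetProj (by norm_num) z) • omega0
    + ∑ σ, ∑ i, (pderiv1 σ i (lagrangeFun lam) (jetProj (by norm_num) z)
        - ∑ j, totalDeriv j (pderiv2 σ i j (lagrangeFun lam)) z) • wedge (contact0 σ z) (omega1 i)
    + ∑ σ, ∑ i, ∑ j, pderiv2 σ i j (lagrangeFun lam) (jetProj (by norm_num) z) •
        wedge (contact1 σ j z) (omega1 i)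

/-! ### The fibered homotopy operator and the canonical Lepage equivalent -/

/-- The fibre scaling `χ(t, ·) : (x^i, y^σ_J) ↦ (x^i, t y^σ_J)`. -/
def fibreScale (t : ℝ) : Jet n m r →L[ℝ] Jet n m r :=
  (ContinuousLinearMap.fst ℝ _ _).prod (t • ContinuousLinearMap.snd ℝ _ _)

/-- The fibered homotopy operator `I ρ = ∫_0^1 ρ^{(0)}(t) dt`, where
`χ^* ρ = dt ∧ ρ^{(0)}(t) + ρ'(t)`. Thus `ρ^{(0)}(t)` at `z` is obtained by inserting the vector
`∂χ/∂t = (0, y^σ_J)` into `ρ` at `χ(t, z)` and pulling back along `χ(t, ·)`. -/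
def homotopyOp (ρ : Form (Jet n m r) (k + 1)) : Form (Jet n m r) k :=
  fun z => ∫ t in (0 : ℝ)..1,
    ((ρ (fibreScale t z)).curryLeft (0, z.2)).compContinuousLinearMap (fibreScale t)

/-- The Vainberg-Tonti Lagrangian `λ_VT = I E_λ` associated to a first order Lagrangian. -/
def vainbergTonti (lam : Form (Jet n m 1) n) : Form (Jet n m 2) n :=
  homotopyOp (eulerLagrangeForm lam)

/-- `μ₀` is a smooth form on the projection of `V` to the base with `d μ₀ = 0^* Θ_λ`. -/
def IsBasePrimitive (V : Set ((Fin (n + 1) → ℝ) × (Fin m → ℝ)))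
    (lam : Form (Jet (n + 1) m 1) (n + 1)) (μ₀ : Form (Fin (n + 1) → ℝ) n) : Prop :=
  ContDiffOn ℝ ∞ μ₀ (Prod.fst '' V) ∧
    ∀ x ∈ Prod.fst '' V, extDeriv μ₀ x = pull zeroSection (Theta1 lam) x

/-- The form `α = I Θ_λ + (π^1)^* μ₀`. -/
def alphaForm (lam : Form (Jet (n + 1) m 1) (n + 1)) (μ₀ : Form (Fin (n + 1) → ℝ) n) :
    Form (Jet (n + 1) m 1) n :=
  fun z => homotopyOp (Theta1 lam) z + pull baseProj μ₀ z

/-- `Φ` is the canonical Lepage equivalent `Θ_{λ_VT} + d α` of the first order Lagrangian `λ`: a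
smooth form on `V²` which satisfies this equation after pullback to `V³`, where the coordinate
formula for `Θ_{λ_VT}` is written. -/
def IsCanonicalLepage (V : Set ((Fin (n + 1) → ℝ) × (Fin m → ℝ)))
    (lam : Form (Jet (n + 1) m 1) (n + 1)) (μ₀ : Form (Fin (n + 1) → ℝ) n)
    (Φ : Form (Jet (n + 1) m 2) (n + 1)) : Prop :=
  ContDiffOn ℝ ∞ Φ (jetSet V 2) ∧
    ∀ z ∈ jetSet V 3, pull (jetProj (by norm_num : 2 ≤ 3)) Φ z =
      Theta2 (vainbergTonti lam) z
        + pull (jetProj (by norm_num : 1 ≤ 3)) (extDeriv (alphaForm lam μ₀)) z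

/-- The form `ν = (1/4) (∂α^j/∂y^σ_i - ∂α^i/∂y^σ_j) ω^σ ∧ ω_{ij}`, where `ω_{ij}` is the interior
product of `∂_j` and `ω_i`. -/
def nuForm (a : Fin (n + 1) → Jet (n + 1) m 1 → ℝ) : Form (Jet (n + 1) m 1) n :=
  fun z => ∑ σ, ∑ i, ∑ j, ((1 / 4 : ℝ) * (pderiv1 σ i (a j) z - pderiv1 σ j (a i) z)) •
    wedgeInterior (contact0 σ z) (dX j) (omega1 i)

end Lepage

end

noncomputable section

namespace Lepage

open Set Filter Topology MeasureTheory

/-! ### Smooth parametric interval integrals -/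

section Parametric

/-! Write `L` for the Lagrange function and `χ_t` for the fibre scaling. Contracting `Θ_λ` with the
vertical vector `∂χ/∂t` leaves only the terms coming from `ω^σ`, so `α^i = y^σ ∫₀¹ (∂L/∂y^σ_i)(χ_t)
dt + μ^i(x)`, where the `μ^i` are the components of `μ₀`.

For (i): total derivatives commute with the scaling. Hence in the sum of the Vainberg-Tonti
integrand `y^σ E_σ(χ_t)` and the integrand of `d_i α^i` the terms `y^σ d_i(∂L/∂y^σ_i)(χ_t)` cancel.
What is left is `d/dt L(χ_t)`, with integral `L - L(x,0)`; the equation for `μ₀` says that the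
divergence of `(μ^i)` supplies the missing `L(x,0)`. See `totalDeriv_alphaComp` and
`pull_eq_vainbergTonti_add`.

For (ii): the Vainberg-Tonti function is `ℓ = L - d_k α^k`. The commutators of `d_k` with the fibre
derivatives (`fderiv_totalDeriv`) give `∂ℓ/∂y^σ_{ij} = -(1/2)(∂α^i/∂y^σ_j + ∂α^j/∂y^σ_i)`, a
function on `V¹`; so no third order coordinate survives in `Θ_ℓ`. Adding `dα` turns the symmetric
part into the antisymmetric one. With `N_{ij}` the coefficients of `ν`, the `ω^σ_j ∧ ω_i` term
becomes `-2 N_{ij}` and the `ω^σ ∧ ω_i` term becomes `∂L/∂y^σ_i - 2 d_j N_{ij}`. These additions to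
`Θ_λ` are exactly `p_1 dν`, by `p1_extDeriv_nuForm`. Uniqueness on `V²` holds because pullback along
the surjection `V³ → V²` is injective.

Existence of `μ₀` is the analytic part. The base domain is an arbitrary open set, so the star-shaped
Poincaré lemma does not apply. A form of top degree is exact as soon as its coefficient is a
divergence, and `exists_diver_eq` solves `div X = f` on any open set: cut `f` along a compact
exhaustion and push the mass of each piece along rays either to infinity or into a point outside the
set, without touching the preceding compact set. -/

theorem continuousOn_slice {E F : Type*} [TopologicalSpace E] [TopologicalSpace F] {a b : ℝ}
    {W : Set (ℝ × E)} {f : ℝ × E → F} (hf : ContinuousOn f W) {x : E} (hx : ∀ t ∈ Icc a b, (t, x) ∈ W) :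
    ContinuousOn (fun t => f (t, x)) (Icc a b) :=
  hf.comp (by fun_prop) hx

theorem intervalIntegrable_slice {E F : Type*} [TopologicalSpace E] [NormedAddCommGroup F] {a b : ℝ}
    {W : Set (ℝ × E)} {f : ℝ × E → F} (hab : a ≤ b) (hf : ContinuousOn f W) {x : E}
    (hx : ∀ t ∈ Icc a b, (t, x) ∈ W) : IntervalIntegrable (fun t => f (t, x)) volume a b :=
  ContinuousOn.intervalIntegrable (by rw [uIcc_of_le hab]; exact continuousOn_slice hf hx)

variable {E F : Type} [NormedAddCommGroup E] [NormedSpace ℝ E] [NormedAddCommGroup F]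
  [NormedSpace ℝ F] {a b : ℝ} {W : Set (ℝ × E)} {f : ℝ × E → F}

/-- Dominated differentiation under the integral. The constant bound comes from compactness: the
derivative is bounded on the segment over `x`, hence by a slightly larger constant on a tube around
it. -/
theorem hasFDerivAt_intervalIntegral (hab : a ≤ b) (hW : IsOpen W) (hf : ContDiffOn ℝ 1 f W)
    {x : E} (hx : ∀ t ∈ Icc a b, (t, x) ∈ W) :
    HasFDerivAt (fun x => ∫ t in a..b, f (t, x))
      (∫ t in a..b, (fderiv ℝ f (t, x)).comp (ContinuousLinearMap.inr ℝ ℝ E)) x := by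
  have hdf : ContinuousOn (fderiv ℝ f) W := hf.continuousOn_fderiv_of_isOpen hW le_rfl
  obtain ⟨C, hC⟩ := isCompact_Icc.exists_bound_of_continuousOn (continuousOn_slice hdf hx)
  have hWo : IsOpen (W ∩ (fun p => ‖fderiv ℝ f p‖) ⁻¹' Iio (C + 1)) :=
    hdf.norm.isOpen_inter_preimage hW isOpen_Iio
  -- The tube lemma makes both membership in `W` and the bound `C + 1` uniform in `t` over a
  -- neighbourhood `v` of `x`.
  obtain ⟨u, v, -, hv, hu, hxv, huv⟩ :=
    generalized_tube_lemma (isCompact_Icc (a := a) (b := b)) (isCompact_singleton (x := x)) hWo (by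
      rintro ⟨t, y⟩ ⟨ht, rfl⟩
      exact ⟨hx t ht, (hC t ht).trans_lt (lt_add_one C)⟩)
  have hvx : v ∈ 𝓝 x := hv.mem_nhds (hxv rfl)
  have hmem : ∀ t ∈ Icc a b, ∀ y ∈ v, (t, y) ∈ W ∧ ‖fderiv ℝ f (t, y)‖ < C + 1 :=
    fun t ht y hy => huv (mk_mem_prod (hu ht) hy)
  have hI : uIoc a b ⊆ Icc a b := by rw [uIoc_of_le hab]; exact Ioc_subset_Icc_self
  refine intervalIntegral.hasFDerivAt_integral_of_dominated_of_fderiv_le (bound := fun _ => C + 1)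
    (F' := fun y t => (fderiv ℝ f (t, y)).comp (ContinuousLinearMap.inr ℝ ℝ E)) hvx ?_
    (intervalIntegrable_slice hab hf.continuousOn hx) ?_ ?_ (by simp) ?_
  · filter_upwards [hvx] with y hy
    exact ((continuousOn_slice hf.continuousOn fun t ht => (hmem t ht y hy).1).mono hI
      ).aestronglyMeasurable measurableSet_uIoc
  · exact (((continuousOn_slice hdf hx).clm_comp continuousOn_const).mono hI
      ).aestronglyMeasurable measurableSet_uIoc
  · refine Eventually.of_forall fun t ht y hy => ?_
    refine (ContinuousLinearMap.opNorm_comp_le _ _).trans ?_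
    refine (mul_le_of_le_one_right (norm_nonneg _) (ContinuousLinearMap.norm_inr_le_one ..)).trans
      (hmem t (hI ht) y hy).2.le
  · refine Eventually.of_forall fun t ht y hy => ?_
    have h1 := ((hf.differentiableOn one_ne_zero).differentiableAt
      (hW.mem_nhds (hmem t (hI ht) y hy).1)).hasFDerivAt
    exact h1.comp y (hasFDerivAt_prodMk_right t y)

/-- The target space is quantified inside the statement because the induction passes from `f` to its
partial derivative, which takes values in a space of linear maps. -/
theorem contDiffOn_intervalIntegral_nat (hab : a ≤ b) (hW : IsOpen W) {O : Set E} (hO : IsOpen O)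
    (hOW : ∀ x ∈ O, ∀ t ∈ Icc a b, (t, x) ∈ W) (n : ℕ) :
    ∀ {F : Type} [NormedAddCommGroup F] [NormedSpace ℝ F] {f : ℝ × E → F}, ContDiffOn ℝ ∞ f W →
      ContDiffOn ℝ n (fun x => ∫ t in a..b, f (t, x)) O := by
  have hder : ∀ {F : Type} [NormedAddCommGroup F] [NormedSpace ℝ F] {f : ℝ × E → F},
      ContDiffOn ℝ ∞ f W → ∀ x ∈ O, HasFDerivAt (fun x => ∫ t in a..b, f (t, x))
      (∫ t in a..b, (fderiv ℝ f (t, x)).comp (ContinuousLinearMap.inr ℝ ℝ E)) x :=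
    fun hf x hx => hasFDerivAt_intervalIntegral hab hW (hf.of_le (by norm_cast)) (hOW x hx)
  induction n with
  | zero =>
    intro F _ _ f hf
    exact contDiffOn_zero.2 fun x hx => (hder hf x hx).continuousAt.continuousWithinAt
  | succ n ih =>
    intro F _ _ f hf
    have h := ih (f := fun p => (fderiv ℝ f p).comp (ContinuousLinearMap.inr ℝ ℝ E))
      ((hf.fderiv_of_isOpen hW (m := ∞) (by simp)).clm_comp contDiffOn_const)
    push_cast
    refine (contDiffOn_succ_iff_fderiv_of_isOpen hO).2
      ⟨fun x hx => (hder hf x hx).differentiableAt.differentiableWithinAt, by simp, ?_⟩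
    exact h.congr fun x hx => (hder hf x hx).fderiv

theorem contDiffOn_intervalIntegral (hab : a ≤ b) (hW : IsOpen W) {O : Set E} (hO : IsOpen O)
    (hOW : ∀ x ∈ O, ∀ t ∈ Icc a b, (t, x) ∈ W) (hf : ContDiffOn ℝ ∞ f W) :
    ContDiffOn ℝ ∞ (fun x => ∫ t in a..b, f (t, x)) O :=
  contDiffOn_infty.2 fun n => contDiffOn_intervalIntegral_nat hab hW hO hOW n hf

end Parametric

/-! ### The divergence equation on an open set -/

/-- The divergence of a vector field on `ℝ^n`. -/
def diver {n : ℕ} (X : (Fin n → ℝ) → (Fin n → ℝ)) (x : Fin n → ℝ) : ℝ :=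
  ∑ i, fderiv ℝ X x (Pi.single i 1) i

section Divergence

variable {n : ℕ}

theorem diver_congr {X Y : (Fin n → ℝ) → (Fin n → ℝ)} {x : Fin n → ℝ} (h : X =ᶠ[𝓝 x] Y) :
    diver X x = diver Y x := by
  simp only [diver, h.fderiv_eq]

theorem diver_sum {ι : Type*} (s : Finset ι) {X : ι → (Fin n → ℝ) → (Fin n → ℝ)} {x : Fin n → ℝ}
    (h : ∀ i ∈ s, DifferentiableAt ℝ (X i) x) :
    diver (fun y => ∑ i ∈ s, X i y) x = ∑ i ∈ s, diver (X i) x := by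
  simp only [diver]
  rw [fderiv_fun_sum h, Finset.sum_comm]
  simp

theorem diver_radial {g : (Fin n → ℝ) → ℝ} {x b : Fin n → ℝ} (hg : DifferentiableAt ℝ g x) :
    diver (fun y => g y • (y - b)) x = n * g x + fderiv ℝ g x (x - b) := by
  have h : HasFDerivAt (fun y => g y • (y - b)) _ x :=
    hg.hasFDerivAt.smul ((hasFDerivAt_id x).sub_const b)
  have hx : x - b = ∑ i, (x - b) i • (Pi.single i 1 : Fin n → ℝ) := (pi_eq_sum_univ' (x - b))
  conv_rhs => rw [hx]
  simp only [diver, h.fderiv, map_sum, map_smul]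
  simp [Finset.sum_add_distrib, mul_comm]

/-- The mass of `h` is transported along the rays issuing from `b`. -/
def radialInt (n : ℕ) (h : (Fin (n + 1) → ℝ) → ℝ) (b : Fin (n + 1) → ℝ) (s₀ s₁ : ℝ)
    (x : Fin (n + 1) → ℝ) : ℝ := ∫ s in s₀..s₁, s ^ n * h (b + s • (x - b))

theorem contDiff_radialInt {h : (Fin (n + 1) → ℝ) → ℝ} (hh : ContDiff ℝ ∞ h)
    (b : Fin (n + 1) → ℝ) {s₀ s₁ : ℝ} (hs : s₀ ≤ s₁) : ContDiff ℝ ∞ (radialInt n h b s₀ s₁) := by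
  rw [← contDiffOn_univ]
  refine contDiffOn_intervalIntegral
    (f := fun p : ℝ × (Fin (n + 1) → ℝ) => p.1 ^ n * h (b + p.1 • (p.2 - b))) hs isOpen_univ
    isOpen_univ (fun _ _ _ _ => mem_univ _) ?_
  rw [contDiffOn_univ]
  fun_prop

/-- The dimension is `n + 1`, so the weight `s ^ n` makes the differentiated integrand the exact
derivative of `s ^ (n + 1) * h (b + s • (x - b))`. Only the two end points of the ray segment
contribute. -/
theorem diver_radialInt {h : (Fin (n + 1) → ℝ) → ℝ} (hh : ContDiff ℝ ∞ h)
    (b : Fin (n + 1) → ℝ) {s₀ s₁ : ℝ} (hs : s₀ ≤ s₁) (x : Fin (n + 1) → ℝ) :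
    diver (fun y => radialInt n h b s₀ s₁ y • (y - b)) x =
      s₁ ^ (n + 1) * h (b + s₁ • (x - b)) - s₀ ^ (n + 1) * h (b + s₀ • (x - b)) := by
  have hd : Differentiable ℝ h := hh.differentiable (by simp)
  have hF : ContDiff ℝ ∞ fun p : ℝ × (Fin (n + 1) → ℝ) => p.1 ^ n * h (b + p.1 • (p.2 - b)) := by
    fun_prop
  have h1 : HasFDerivAt (radialInt n h b s₀ s₁) _ x := hasFDerivAt_intervalIntegral hs isOpen_univ
    ((hF.of_le (by norm_cast)).contDiffOn) (x := x) (fun _ _ => mem_univ _)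
  -- The chain rule yields one more factor `s`, which raises the weight from `n` to `n + 1`.
  have h2 : ∀ s : ℝ, fderiv ℝ (fun p : ℝ × (Fin (n + 1) → ℝ) => p.1 ^ n * h (b + p.1 • (p.2 - b)))
      (s, x) (0, x - b) = s ^ (n + 1) * fderiv ℝ h (b + s • (x - b)) (x - b) := by
    intro s
    have e1 := (((hF.differentiable (by simp)) (s, x)).hasFDerivAt).comp x
      (hasFDerivAt_prodMk_right s x)
    have e2 : HasFDerivAt (fun y : Fin (n + 1) → ℝ => b + s • (y - b)) (s • .id ℝ _) x :=
      (((hasFDerivAt_id x).sub_const b).const_smul s).const_add b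
    have e3 := (((hd (b + s • (x - b))).hasFDerivAt).comp x e2).const_mul (s ^ n)
    have e4 := congrArg (fun L => L (x - b)) (e1.unique e3)
    simp only [ContinuousLinearMap.comp_apply, ContinuousLinearMap.inr_apply] at e4
    rw [e4]
    simp [pow_succ, mul_assoc]
  have hint : IntervalIntegrable (fun s : ℝ => (fderiv ℝ
      (fun p : ℝ × (Fin (n + 1) → ℝ) => p.1 ^ n * h (b + p.1 • (p.2 - b))) (s, x)).comp
      (ContinuousLinearMap.inr ℝ ℝ _)) volume s₀ s₁ := by
    refine Continuous.intervalIntegrable ?_ _ _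
    exact ((hF.continuous_fderiv (by simp)).comp (by fun_prop)).clm_comp continuous_const
  have hc : Continuous (fderiv ℝ h) := hh.continuous_fderiv (by simp)
  rw [diver_radial h1.differentiableAt, h1.fderiv,
    ContinuousLinearMap.intervalIntegral_apply hint, radialInt,
    ← intervalIntegral.integral_const_mul, ← intervalIntegral.integral_add]
  · have hderiv : ∀ s ∈ uIcc s₀ s₁, HasDerivAt (fun s : ℝ => s ^ (n + 1) * h (b + s • (x - b)))
        (((n + 1 : ℕ) : ℝ) * (s ^ n * h (b + s • (x - b))) +
          s ^ (n + 1) * fderiv ℝ h (b + s • (x - b)) (x - b)) s := by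
      intro s _
      have e1 : HasDerivAt (fun s : ℝ => b + s • (x - b)) (x - b) s := by
        simpa using ((hasDerivAt_id s).smul_const (x - b)).const_add b
      have e2 := (hasDerivAt_pow (n + 1) s).mul ((hd (b + s • (x - b))).hasFDerivAt.comp_hasDerivAt s e1)
      refine e2.congr_deriv ?_
      simp [mul_assoc]
    rw [← intervalIntegral.integral_eq_sub_of_hasDerivAt hderiv]
    · refine intervalIntegral.integral_congr fun s _ => ?_
      simp only [ContinuousLinearMap.comp_apply, ContinuousLinearMap.inr_apply, h2]
    · refine Continuous.intervalIntegrable ?_ _ _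
      have := hh.continuous
      fun_prop
  · refine Continuous.intervalIntegrable ?_ _ _
    have := hh.continuous
    fun_prop
  · simp only [ContinuousLinearMap.comp_apply, ContinuousLinearMap.inr_apply, h2]
    refine Continuous.intervalIntegrable ?_ _ _
    fun_prop

end Divergence

/-! ### Solving `div X = f` by transport of mass out of the open set. -/

section DivergenceEquation

variable {n : ℕ}

/-- Transport to infinity along the rays issuing from the origin. -/
theorem exists_diver_eq_outward {h : (Fin (n + 1) → ℝ) → ℝ} (hh : ContDiff ℝ ∞ h) :
    ∃ Y : (Fin (n + 1) → ℝ) → (Fin (n + 1) → ℝ), ContDiff ℝ ∞ Y ∧ (∀ x, diver Y x = h x) ∧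
      ∀ R : ℝ, (∀ y, ‖y‖ ≤ R → h y = 0) → ∀ x, ‖x‖ ≤ R → Y x = 0 := by
  refine ⟨fun x => radialInt n h 0 0 1 x • (x - 0),
    (contDiff_radialInt hh 0 zero_le_one).smul (by fun_prop), fun x => ?_, fun R hR x hx => ?_⟩
  · rw [diver_radialInt hh 0 zero_le_one]
    simp
  · have : radialInt n h 0 0 1 x = 0 := by
      rw [radialInt]
      refine intervalIntegral.integral_zero_ae (Eventually.of_forall fun s hs => ?_)
      rw [uIoc_of_le zero_le_one] at hs
      rw [hR, mul_zero]
      rw [sub_zero, zero_add, norm_smul, Real.norm_of_nonneg hs.1.le]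
      exact (mul_le_of_le_one_left (norm_nonneg _) hs.2).trans hx
    simp only [this, zero_smul]

/-- Transport towards a point `b`, where the field may be singular. -/
theorem exists_diver_eq_inward {h : (Fin (n + 1) → ℝ) → ℝ} (hh : ContDiff ℝ ∞ h)
    (b : Fin (n + 1) → ℝ) {ε : ℝ} (hε : ∀ y, ε ≤ dist y b → h y = 0) :
    ∃ Y : (Fin (n + 1) → ℝ) → (Fin (n + 1) → ℝ), ContDiffOn ℝ ∞ Y {b}ᶜ ∧
      (∀ x ≠ b, diver Y x = h x) ∧ ∀ x, ε ≤ dist x b → Y x = 0 := by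
  -- The ray is followed from `x` away from `b`. The boundary term at `s = 1` enters with a minus
  -- sign, which the sign in front of the integral repairs.
  set Y : (Fin (n + 1) → ℝ) → (Fin (n + 1) → ℝ) :=
    fun x => (-∫ s in Ioi (1 : ℝ), s ^ n * h (b + s • (x - b))) • (x - b) with hY
  have hfar : ∀ (x : Fin (n + 1) → ℝ) (s : ℝ), 0 ≤ s → ε ≤ s * ‖x - b‖ →
      h (b + s • (x - b)) = 0 := by
    intro x s hs hx
    apply hε
    rwa [dist_eq_norm, add_sub_cancel_left, norm_smul, Real.norm_of_nonneg hs]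
  -- Near `x ≠ b` the distance to `b` stays above half its value at `x`, so a single cut-off `M`
  -- puts the rest of every nearby ray outside the support of `h`. This replaces the improper
  -- integral by a smooth one whose boundary term at `M` vanishes.
  have hloc : ∀ x ≠ b, ∃ M : ℝ, 1 ≤ M ∧ h (b + M • (x - b)) = 0 ∧
      Y =ᶠ[𝓝 x] fun y => -(radialInt n h b 1 M y • (y - b)) := by
    intro x hx
    have hr : 0 < ‖x - b‖ / 2 := half_pos (norm_pos_iff.2 (sub_ne_zero.2 hx))
    obtain ⟨M, hM1, hM⟩ : ∃ M : ℝ, 1 ≤ M ∧ ε ≤ M * (‖x - b‖ / 2) :=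
      ⟨max 1 (ε / (‖x - b‖ / 2)), le_max_left _ _, (div_le_iff₀ hr).1 (le_max_right _ _)⟩
    have hM0 : (0 : ℝ) ≤ M := zero_le_one.trans hM1
    refine ⟨M, hM1, hfar x M hM0 (hM.trans ?_), ?_⟩
    · exact mul_le_mul_of_nonneg_left (half_le_self (norm_nonneg _)) hM0
    have hev : ∀ᶠ y in 𝓝 x, ‖x - b‖ / 2 < ‖y - b‖ := by
      have : Continuous fun y : Fin (n + 1) → ℝ => ‖y - b‖ := by fun_prop
      exact this.continuousAt.eventually (lt_mem_nhds (half_lt_self (by linarith)))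
    filter_upwards [hev] with y hy
    rw [hY]
    simp only
    rw [neg_smul, radialInt, intervalIntegral.integral_of_le hM1]
    rw [setIntegral_eq_of_subset_of_forall_sdiff_eq_zero (s := Ioc 1 M) measurableSet_Ioi
      (fun s hs => hs.1) fun s hs => ?_]
    have hs1 : M < s := by
      by_contra hcon
      exact hs.2 ⟨hs.1, not_lt.1 hcon⟩
    rw [hfar y s (hM0.trans hs1.le), mul_zero]
    exact hM.trans (mul_le_mul hs1.le hy.le hr.le (hM0.trans hs1.le))
  refine ⟨Y, fun x hx => ?_, fun x hx => ?_, fun x hx => ?_⟩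
  · obtain ⟨M, hM, -, hYM⟩ := hloc x hx
    refine (ContDiffAt.congr_of_eventuallyEq ?_ hYM).contDiffWithinAt
    exact (((contDiff_radialInt hh b hM).smul (contDiff_id.sub contDiff_const)).neg).contDiffAt
  · obtain ⟨M, hM, hzero, hYM⟩ := hloc x hx
    have hneg : diver (fun y => -(radialInt n h b 1 M y • (y - b))) x =
        -diver (fun y => radialInt n h b 1 M y • (y - b)) x := by
      simp only [diver, fderiv_fun_neg]
      simp
    rw [diver_congr hYM, hneg, diver_radialInt hh b hM, hzero]
    simp
  · have : ∫ s in Ioi (1 : ℝ), s ^ n * h (b + s • (x - b)) = 0 := by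
      refine setIntegral_eq_zero_of_forall_eq_zero fun s hs => ?_
      have hs0 : (1 : ℝ) ≤ s := le_of_lt hs
      rw [hfar x s (zero_le_one.trans hs0), mul_zero]
      rw [dist_eq_norm] at hx
      exact hx.trans (le_mul_of_one_le_left (norm_nonneg _) hs0)
    simp only [hY, this, neg_zero, zero_smul]

/-- The standard exhaustion of an open set by compact sets none of whose complementary components
is relatively compact. -/
def exhaust (U : Set (Fin (n + 1) → ℝ)) (j : ℕ) : Set (Fin (n + 1) → ℝ) :=
  {x | ‖x‖ ≤ j ∧ ∀ b ∉ U, 1 / ((j : ℝ) + 1) ≤ dist x b}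

theorem isClosed_exhaust (U : Set (Fin (n + 1) → ℝ)) (j : ℕ) : IsClosed (exhaust U j) := by
  simp only [exhaust, ofPred_and, ofPred_forall]
  refine (isClosed_le continuous_norm continuous_const).inter ?_
  exact isClosed_iInter fun b => isClosed_iInter fun _ =>
    isClosed_le continuous_const (continuous_id.dist continuous_const)

theorem exhaust_subset (U : Set (Fin (n + 1) → ℝ)) (j : ℕ) : exhaust U j ⊆ U := by
  intro x hx
  by_contra hxU
  have := hx.2 x hxU
  rw [dist_self] at this
  exact absurd this (not_le.2 (by positivity))

theorem exhaust_subset_interior (U : Set (Fin (n + 1) → ℝ)) (j : ℕ) :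
    exhaust U j ⊆ interior (exhaust U (j + 1)) := by
  intro x hx
  have hlt : 1 / (((j + 1 : ℕ) : ℝ) + 1) < 1 / ((j : ℝ) + 1) := by
    apply one_div_lt_one_div_of_lt (by positivity)
    push_cast
    linarith
  rw [mem_interior_iff_mem_nhds]
  -- The two entries are the slack gained in the norm bound and in the distance bound when `j` grows
  -- by one.
  have hr : 0 < min 1 (1 / ((j : ℝ) + 1) - 1 / (((j + 1 : ℕ) : ℝ) + 1)) :=
    lt_min one_pos (sub_pos.2 hlt)
  filter_upwards [Metric.ball_mem_nhds x hr] with y hy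
  rw [Metric.mem_ball, lt_min_iff] at hy
  refine ⟨?_, fun b hb => ?_⟩
  · have h1 : ‖y‖ ≤ ‖y - x‖ + ‖x‖ := by simpa using norm_add_le (y - x) x
    rw [← dist_eq_norm] at h1
    push_cast
    linarith [hx.1]
  · have h1 := hx.2 b hb
    have h2 := dist_triangle x y b
    rw [dist_comm x y] at h2
    linarith

theorem exhaust_mono (U : Set (Fin (n + 1) → ℝ)) : Monotone (exhaust U) :=
  monotone_nat_of_le_succ fun j => (exhaust_subset_interior U j).trans interior_subset

theorem exists_mem_exhaust {U : Set (Fin (n + 1) → ℝ)} (hU : IsOpen U) {x : Fin (n + 1) → ℝ}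
    (hx : x ∈ U) : ∃ j, x ∈ exhaust U j := by
  obtain ⟨ε, hε, hball⟩ := Metric.isOpen_iff.1 hU x hx
  obtain ⟨j₁, hj₁⟩ := exists_nat_one_div_lt hε
  obtain ⟨j₂, hj₂⟩ := exists_nat_ge ‖x‖
  refine ⟨max j₁ j₂, hj₂.trans (by exact_mod_cast le_max_right _ _), fun b hb => ?_⟩
  have h1 : ε ≤ dist x b := by
    by_contra hcon
    exact hb (hball (by rw [Metric.mem_ball, dist_comm]; exact not_le.1 hcon))
  refine le_trans ?_ (hj₁.le.trans h1)
  apply one_div_le_one_div_of_le (by positivity)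
  gcongr
  exact le_max_left _ _

/-- A point misses `exhaust U j` exactly when it has norm above `j` or is closer than `1 / (j + 1)`
to some `b ∉ U`. A partition of unity splits `h` accordingly: mass far out is sent to infinity, mass
near `b` is sent into `b`. The singularity at `b` is harmless because `b ∉ U`, and neither transport
meets `exhaust U j`. -/
theorem exists_diver_eq_off_exhaust {U : Set (Fin (n + 1) → ℝ)} (hU : IsOpen U) (j : ℕ)
    {h : (Fin (n + 1) → ℝ) → ℝ} (hh : ContDiff ℝ ∞ h) (hc : HasCompactSupport h)
    (hd : Disjoint (tsupport h) (exhaust U j)) :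
    ∃ Y : (Fin (n + 1) → ℝ) → (Fin (n + 1) → ℝ), ContDiffOn ℝ ∞ Y U ∧
      (∀ x ∈ U, diver Y x = h x) ∧ ∀ x ∈ exhaust U j, Y x = 0 := by
  classical
  -- `none` indexes the region outside the closed ball of radius `j`, `some b` the ball around a
  -- point `b` of the complement.
  let W : Option (↥Uᶜ) → Set (Fin (n + 1) → ℝ) := fun o =>
    o.elim {x | (j : ℝ) < ‖x‖} fun b => Metric.ball b (1 / ((j : ℝ) + 1))
  have hWo : ∀ o, IsOpen (W o) := by
    rintro (_ | b)
    · exact isOpen_lt continuous_const continuous_norm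
    · exact Metric.isOpen_ball
  have hcov : tsupport h ⊆ ⋃ o, W o := by
    intro x hx
    by_contra hcon
    simp only [mem_iUnion, not_exists] at hcon
    refine disjoint_left.1 hd hx ⟨not_lt.1 (hcon none), fun b hb => ?_⟩
    exact not_lt.1 (hcon (some ⟨b, hb⟩))
  obtain ⟨ρ, hρ⟩ := SmoothPartitionOfUnity.exists_isSubordinate
    (modelWithCornersSelf ℝ (Fin (n + 1) → ℝ)) (isClosed_tsupport h) W hWo hcov
  have hfin := ρ.locallyFinite.finite_nonempty_inter_compact hc.isCompact
  have hsum : ∀ x, ∑ o ∈ hfin.toFinset, ρ o x * h x = h x := by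
    intro x
    by_cases hx : x ∈ tsupport h
    · rw [← Finset.sum_mul, ρ.sum_finsupport' x hx, one_mul]
      intro o ho
      rw [SmoothPartitionOfUnity.mem_finsupport] at ho
      exact hfin.mem_toFinset.2 ⟨x, ho, hx⟩
    · simp [image_eq_zero_of_notMem_tsupport hx]
  have hex : ∀ o, ∃ Y : (Fin (n + 1) → ℝ) → (Fin (n + 1) → ℝ), ContDiffOn ℝ ∞ Y U ∧
      (∀ x ∈ U, diver Y x = ρ o x * h x) ∧ ∀ x ∈ exhaust U j, Y x = 0 := by
    intro o
    have hs : ContDiff ℝ ∞ fun x => ρ o x * h x := (ρ o).contMDiff.contDiff.mul hh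
    have hz : ∀ x ∉ W o, ρ o x * h x = 0 := fun x hx => by
      rw [image_eq_zero_of_notMem_tsupport fun hx' => hx (hρ o hx'), zero_mul]
    rcases o with _ | ⟨b, hb⟩
    · obtain ⟨Y, hY, hYd, hY0⟩ := exists_diver_eq_outward hs
      refine ⟨Y, hY.contDiffOn, fun x _ => hYd x, fun x hx => hY0 j (fun y hy => ?_) x hx.1⟩
      exact hz y (not_lt.2 hy)
    · obtain ⟨Y, hY, hYd, hY0⟩ := exists_diver_eq_inward hs b (ε := 1 / ((j : ℝ) + 1))
        fun y hy => hz y (not_lt.2 hy)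
      have hne : ∀ x ∈ U, x ≠ b := fun x hx hxb => hb (hxb ▸ hx)
      exact ⟨Y, hY.mono hne, fun x hx => hYd x (hne x hx), fun x hx => hY0 x (hx.2 b hb)⟩
  choose Y hY hYd hY0 using hex
  refine ⟨fun x => ∑ o ∈ hfin.toFinset, Y o x, ContDiffOn.sum fun o _ => hY o, fun x hx => ?_,
    fun x hx => Finset.sum_eq_zero fun o _ => hY0 o x hx⟩
  rw [diver_sum _ fun o _ => ((hY o).contDiffAt (hU.mem_nhds hx)).differentiableAt (by simp),
    ← hsum x]
  exact Finset.sum_congr rfl fun o _ => hYd o x hx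

theorem exists_cutoff (U : Set (Fin (n + 1) → ℝ)) (j : ℕ) :
    ∃ χ : (Fin (n + 1) → ℝ) → ℝ, ContDiff ℝ ∞ χ ∧ (∀ x ∈ exhaust U j, χ =ᶠ[𝓝 x] 1) ∧
      tsupport χ ⊆ exhaust U (j + 1) := by
  obtain ⟨f, hf1, hf0, -⟩ := exists_contMDiffMap_one_nhds_of_subset_interior (n := ⊤)
    (modelWithCornersSelf ℝ (Fin (n + 1) → ℝ)) (isClosed_exhaust U j) (exhaust_subset_interior U j)
  refine ⟨f, f.contMDiff.contDiff, fun x hx => ?_, ?_⟩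
  · exact (eventually_nhdsSet_iff_forall.1 hf1) x hx
  · refine closure_minimal (fun x hx => ?_) (isClosed_exhaust U _)
    by_contra hcon
    exact hx (hf0 x hcon)

theorem isCompact_exhaust (U : Set (Fin (n + 1) → ℝ)) (j : ℕ) : IsCompact (exhaust U j) :=
  (isCompact_closedBall (0 : Fin (n + 1) → ℝ) j).of_isClosed_subset (isClosed_exhaust U j)
    fun x hx => by simpa using hx.1

/-- On every open set of `ℝ^n`, `n ≥ 1`, every smooth function is the divergence of a smooth
vector field. -/
theorem exists_diver_eq {U : Set (Fin (n + 1) → ℝ)} (hU : IsOpen U) {f : (Fin (n + 1) → ℝ) → ℝ}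
    (hf : ContDiffOn ℝ ∞ f U) :
    ∃ X : (Fin (n + 1) → ℝ) → (Fin (n + 1) → ℝ), ContDiffOn ℝ ∞ X U ∧
      ∀ x ∈ U, diver X x = f x := by
  choose χ hχ hχ1 hχs using exists_cutoff U
  -- Smooth on the whole space although `f` is only smooth on `U`: the support of the cutoff lies in
  -- an `exhaust` set, hence in `U`.
  have hsmooth : ∀ j, ContDiff ℝ ∞ fun x => χ j x * f x := by
    intro j
    rw [contDiff_iff_contDiffAt]
    intro x
    by_cases hx : x ∈ tsupport (χ j)
    · exact (hχ j).contDiffAt.mul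
        (hf.contDiffAt (hU.mem_nhds (exhaust_subset U _ (hχs j hx))))
    · refine contDiffAt_const (c := (0 : ℝ)) |>.congr_of_eventuallyEq ?_
      filter_upwards [notMem_tsupport_iff_eventuallyEq.1 hx] with y hy
      rw [hy, Pi.zero_apply, zero_mul]
  obtain ⟨Y₀, hY₀, hY₀d, -⟩ := exists_diver_eq_outward (hsmooth 0)
  -- Both cutoffs equal one near `exhaust U j`, so their difference is supported off it and the
  -- correction can be taken to vanish there.
  have hstep : ∀ j, ∃ Y : (Fin (n + 1) → ℝ) → (Fin (n + 1) → ℝ), ContDiffOn ℝ ∞ Y U ∧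
      (∀ x ∈ U, diver Y x = χ (j + 1) x * f x - χ j x * f x) ∧ ∀ x ∈ exhaust U j, Y x = 0 := by
    intro j
    refine exists_diver_eq_off_exhaust hU j ((hsmooth (j + 1)).sub (hsmooth j)) ?_ ?_
    · refine HasCompactSupport.intro (isCompact_exhaust U (j + 2)) fun x hx => ?_
      have h1 : χ (j + 1) x = 0 := image_eq_zero_of_notMem_tsupport fun h => hx (hχs _ h)
      have h2 : χ j x = 0 := image_eq_zero_of_notMem_tsupport
        fun h => hx (exhaust_mono U (Nat.le_succ _) (hχs _ h))
      rw [h1, h2, sub_self]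
    · refine disjoint_left.2 fun x hx hxK => ?_
      refine notMem_tsupport_iff_eventuallyEq.2 ?_ hx
      filter_upwards [hχ1 j x hxK, hχ1 (j + 1) x (exhaust_mono U (Nat.le_succ _) hxK)] with y h1 h2
      rw [h1, h2]
      simp
  choose Y hY hYd hY0 using hstep
  -- On `exhaust U J` all corrections with index at least `J` vanish, so the infinite sum is locally
  -- finite.
  have hlocal : ∀ J, ∀ y ∈ exhaust U J,
      Y₀ y + ∑ᶠ j, Y j y = Y₀ y + ∑ j ∈ Finset.range J, Y j y := by
    intro J y hy
    congr 1
    refine finsum_eq_sum_of_support_subset _ fun j hj => ?_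
    by_contra hcon
    simp only [Finset.coe_range, mem_Iio, not_lt] at hcon
    exact hj (hY0 j y (exhaust_mono U hcon hy))
  have hev : ∀ x ∈ U, ∃ J, x ∈ exhaust U J ∧ (fun y => Y₀ y + ∑ᶠ j, Y j y) =ᶠ[𝓝 x]
      fun y => Y₀ y + ∑ j ∈ Finset.range J, Y j y := by
    intro x hx
    obtain ⟨j, hj⟩ := exists_mem_exhaust hU hx
    have hj' := exhaust_subset_interior U j hj
    refine ⟨j + 1, interior_subset hj', ?_⟩
    filter_upwards [mem_interior_iff_mem_nhds.1 hj'] with y hy using hlocal _ y hy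
  refine ⟨fun y => Y₀ y + ∑ᶠ j, Y j y, fun x hx => ?_, fun x hx => ?_⟩
  · obtain ⟨J, -, hJ⟩ := hev x hx
    refine (ContDiffAt.congr_of_eventuallyEq ?_ hJ).contDiffWithinAt
    exact hY₀.contDiffAt.add (ContDiffAt.sum fun j _ => (hY j).contDiffAt (hU.mem_nhds hx))
  · obtain ⟨J, hxJ, hJ⟩ := hev x hx
    have hdiff : ∀ j ∈ Finset.range J, DifferentiableAt ℝ (Y j) x := fun j _ =>
      ((hY j).contDiffAt (hU.mem_nhds hx)).differentiableAt (by simp)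
    have hadd : diver (fun y => Y₀ y + ∑ j ∈ Finset.range J, Y j y) x =
        diver Y₀ x + diver (fun y => ∑ j ∈ Finset.range J, Y j y) x := by
      simp only [diver]
      rw [fderiv_fun_add (hY₀.differentiable (by simp) x) (DifferentiableAt.fun_sum hdiff)]
      simp [Finset.sum_add_distrib]
    -- The divergences telescope to `χ J * f`, and `χ J` equals one at `x`.
    rw [diver_congr hJ, hadd, diver_sum _ hdiff, hY₀d,
      Finset.sum_congr rfl fun j _ => hYd j x hx,
      Finset.sum_range_sub (fun j => χ j x * f x), add_sub_cancel, (hχ1 J x hxJ).eq_of_nhds,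
      Pi.one_apply, one_mul]

end DivergenceEquation

/-! ### Exterior algebra -/

section Wedge

variable {E F : Type} [NormedAddCommGroup E] [NormedSpace ℝ E] [NormedAddCommGroup F]
  [NormedSpace ℝ F] {k : ℕ}

/-- The exterior product of 1-forms with `k`-forms as a continuous bilinear map. -/
def wedgeCLM (E : Type) [NormedAddCommGroup E] [NormedSpace ℝ E] (k : ℕ) :
    (E →L[ℝ] ℝ) →L[ℝ] E [⋀^Fin k]→L[ℝ] ℝ →L[ℝ] E [⋀^Fin (k + 1)]→L[ℝ] ℝ :=
  (ContinuousLinearMap.compL ℝ _ _ _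
    (ContinuousAlternatingMap.alternatizeUncurryFinCLM ℝ E ℝ)).comp
    (ContinuousLinearMap.smulRightL ℝ E (E [⋀^Fin k]→L[ℝ] ℝ))

theorem wedge_eq (θ : E →L[ℝ] ℝ) (η : E [⋀^Fin k]→L[ℝ] ℝ) : wedge θ η = wedgeCLM E k θ η := rfl

theorem wedge_apply (θ : E →L[ℝ] ℝ) (η : E [⋀^Fin k]→L[ℝ] ℝ) (v : Fin (k + 1) → E) :
    wedge θ η v = ∑ i : Fin (k + 1), (-1) ^ (i : ℕ) * (θ (v i) * η (i.removeNth v)) := by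
  simp [wedge, ContinuousAlternatingMap.alternatizeUncurryFin_apply]

@[simp] theorem wedge_zero_left (η : E [⋀^Fin k]→L[ℝ] ℝ) : wedge 0 η = 0 := by simp [wedge_eq]

@[simp] theorem wedge_zero_right (θ : E →L[ℝ] ℝ) : wedge θ (0 : E [⋀^Fin k]→L[ℝ] ℝ) = 0 := by
  simp [wedge_eq]

theorem wedge_add_left (θ φ : E →L[ℝ] ℝ) (η : E [⋀^Fin k]→L[ℝ] ℝ) :
    wedge (θ + φ) η = wedge θ η + wedge φ η := by simp [wedge_eq]

theorem wedge_smul_left (c : ℝ) (θ : E →L[ℝ] ℝ) (η : E [⋀^Fin k]→L[ℝ] ℝ) :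
    wedge (c • θ) η = c • wedge θ η := by simp [wedge_eq]

theorem wedge_sum_left {ι : Type*} (s : Finset ι) (θ : ι → E →L[ℝ] ℝ) (η : E [⋀^Fin k]→L[ℝ] ℝ) :
    wedge (∑ i ∈ s, θ i) η = ∑ i ∈ s, wedge (θ i) η := by
  simp [wedge_eq]

theorem wedge_sub_right (θ : E →L[ℝ] ℝ) (η ξ : E [⋀^Fin k]→L[ℝ] ℝ) :
    wedge θ (η - ξ) = wedge θ η - wedge θ ξ := by simp [wedge_eq]

theorem wedge_smul_right (c : ℝ) (θ : E →L[ℝ] ℝ) (η : E [⋀^Fin k]→L[ℝ] ℝ) :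
    wedge θ (c • η) = c • wedge θ η := by simp [wedge_eq]

theorem wedge_comp (θ : F →L[ℝ] ℝ) (η : F [⋀^Fin k]→L[ℝ] ℝ) (g : E →L[ℝ] F) :
    (wedge θ η).compContinuousLinearMap g =
      wedge (θ.comp g) (η.compContinuousLinearMap g) := by
  ext v
  simp only [ContinuousAlternatingMap.compContinuousLinearMap_apply, wedge_apply]
  rfl

/-- A Leibniz rule: the single argument transformed by `P` is fed either to `θ` or to `η`. -/
theorem wedge_fderivComp (θ : F →L[ℝ] ℝ) (η : F [⋀^Fin k]→L[ℝ] ℝ) (H P : E →L[ℝ] F) :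
    (wedge θ η).fderivCompContinuousLinearMap H P =
      wedge (θ.comp P) (η.compContinuousLinearMap H) +
        wedge (θ.comp H) (η.fderivCompContinuousLinearMap H P) := by
  have key : ∀ {k : ℕ} (A : F [⋀^Fin k]→L[ℝ] ℝ) (v : Fin k → E),
      A.fderivCompContinuousLinearMap H P v =
        ∑ i, A (fun j => if j = i then P (v j) else H (v j)) := by
    intro k A v
    rw [ContinuousAlternatingMap.fderivCompContinuousLinearMap_apply]
    refine Finset.sum_congr rfl fun i _ => congrArg _ (funext fun j => ?_)
    by_cases h : j = i
    · subst h; simp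
    · simp [h]
  ext v
  simp only [ContinuousAlternatingMap.add_apply, key, wedge_apply,
    ContinuousAlternatingMap.compContinuousLinearMap_apply, ContinuousLinearMap.comp_apply]
  rw [Finset.sum_comm, ← Finset.sum_add_distrib]
  refine Finset.sum_congr rfl fun l _ => ?_
  -- `l` is the slot consumed by `θ`; the slot of `P` is either `l` itself or one of the slots left
  -- for `η`.
  rw [← Finset.mul_sum, ← mul_add, Fin.sum_univ_succAbove _ l, Finset.mul_sum]
  congr 2
  · rw [if_pos rfl]
    congr 2
    funext j
    simp [Fin.removeNth]
  · refine Finset.sum_congr rfl fun i _ => ?_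
    rw [if_neg (Fin.succAbove_ne l i).symm]
    congr 2
    funext j
    simp [Fin.removeNth]

/-- Double alternatization kills `θ ⊗ θ ⊗ η`, which is symmetric in its first two arguments. -/
theorem wedge_wedge_self (θ : E →L[ℝ] ℝ) (η : E [⋀^Fin k]→L[ℝ] ℝ) : wedge θ (wedge θ η) = 0 := by
  have h := ContinuousAlternatingMap.alternatizeUncurryFin_alternatizeUncurryFinCLM_comp_of_symmetric
    (f := θ.smulRight (θ.smulRight η)) (fun x y => by
      ext v
      simp
      ring)
  rw [← h, wedge]
  congr 1
  ext u v
  simp [wedge]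

theorem wedge_wedge_comm (θ φ : E →L[ℝ] ℝ) (η : E [⋀^Fin k]→L[ℝ] ℝ) :
    wedge θ (wedge φ η) = -wedge φ (wedge θ η) := by
  have h := wedge_wedge_self (θ + φ) η
  have hr : ∀ θ : E →L[ℝ] ℝ, wedge θ (wedge θ η + wedge φ η) =
      wedge θ (wedge θ η) + wedge θ (wedge φ η) := fun θ => by simp [wedge_eq]
  have hr' : wedge φ (wedge θ η + wedge φ η) =
      wedge φ (wedge θ η) + wedge φ (wedge φ η) := by simp [wedge_eq]
  rw [wedge_add_left, wedge_add_left, hr, hr', wedge_wedge_self, wedge_wedge_self, zero_add,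
    add_zero] at h
  exact eq_neg_of_add_eq_zero_left h

/-- The antiderivation property of the interior product. Writing the second term with
`wedgeInterior` covers degree zero, where that term is absent. -/
theorem curryLeft_wedge (θ : E →L[ℝ] ℝ) (η : E [⋀^Fin k]→L[ℝ] ℝ) (X : E) :
    (wedge θ η).curryLeft X = θ X • η - wedgeInterior θ X η := by
  cases k with
  | zero =>
    ext v
    simp [wedge_apply, wedgeInterior]
  | succ k =>
    ext v
    simp only [ContinuousAlternatingMap.curryLeft_apply_apply, wedge_apply, wedgeInterior,
      ContinuousAlternatingMap.sub_apply, ContinuousAlternatingMap.smul_apply, smul_eq_mul]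
    rw [Fin.sum_univ_succ, sub_eq_add_neg, ← Finset.sum_neg_distrib]
    congr 1
    · simp [Matrix.vecCons]
    · refine Finset.sum_congr rfl fun i _ => ?_
      have : (i.succ.removeNth (Matrix.vecCons X v) : Fin (k + 1) → E) =
          Matrix.vecCons X (i.removeNth v) := by
        funext j
        refine Fin.cases ?_ (fun j => ?_) j
        · simp [Fin.removeNth]
        · simp [Fin.removeNth]
      rw [this]
      simp [pow_succ]

/-- `wedgeInterior` as a continuous linear function of the 1-form. -/
def wedgeInteriorCLM (X : E) : {k : ℕ} → E [⋀^Fin k]→L[ℝ] ℝ → (E →L[ℝ] ℝ) →L[ℝ] E [⋀^Fin k]→L[ℝ] ℝ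
  | 0, _ => 0
  | k + 1, η => (wedgeCLM E k).flip (η.curryLeft X)

theorem wedgeInterior_eq (θ : E →L[ℝ] ℝ) (X : E) (η : E [⋀^Fin k]→L[ℝ] ℝ) :
    wedgeInterior θ X η = wedgeInteriorCLM X η θ := by
  cases k <;> rfl

theorem wedge_wedgeInterior_comm (θ φ : E →L[ℝ] ℝ) (X : E) (η : E [⋀^Fin k]→L[ℝ] ℝ) :
    wedge θ (wedgeInterior φ X η) = -wedge φ (wedgeInterior θ X η) := by
  cases k with
  | zero => simp [wedgeInterior]
  | succ k => exact wedge_wedge_comm θ φ _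

theorem wedgeInterior_of_curryLeft_eq_zero (θ : E →L[ℝ] ℝ) (X : E) (η : E [⋀^Fin (k + 1)]→L[ℝ] ℝ)
    (h : η.curryLeft X = 0) : wedgeInterior θ X η = 0 := by
  simp [wedgeInterior, h]

theorem extDeriv_smul_const {f : E → ℝ} {x : E} (hf : DifferentiableAt ℝ f x)
    (η : E [⋀^Fin k]→L[ℝ] ℝ) : extDeriv (fun z => f z • η) x = wedge (fderiv ℝ f x) η := by
  rw [extDeriv, (hf.hasFDerivAt.smul_const η).fderiv]
  rfl

theorem extDeriv_sum {ι : Type*} (s : Finset ι) {ρ : ι → E → E [⋀^Fin k]→L[ℝ] ℝ} {x : E}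
    (h : ∀ i ∈ s, DifferentiableAt ℝ (ρ i) x) :
    extDeriv (fun z => ∑ i ∈ s, ρ i z) x = ∑ i ∈ s, extDeriv (ρ i) x := by
  simp only [extDeriv]
  rw [fderiv_fun_sum h, ← ContinuousAlternatingMap.alternatizeUncurryFinCLM_apply, map_sum]
  rfl

end Wedge

/-! ### Forms on the base -/

section Base

variable {n : ℕ}

/-- The form `i_{∂_i}(dx^1 ∧ ... ∧ dx^n)` on the base. -/
def baseVol1 (i : Fin (n + 1)) : (Fin (n + 1) → ℝ) [⋀^Fin n]→L[ℝ] ℝ :=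
  (baseVol (n + 1)).curryLeft (Pi.single i 1)

theorem baseVol_apply (v : Fin n → Fin n → ℝ) : baseVol n v = Matrix.det v := rfl

theorem baseVol_single : baseVol n (fun i => Pi.single i 1) = 1 := by
  rw [baseVol_apply]
  have h : (fun i => Pi.single i 1 : Fin n → Fin n → ℝ) = (1 : Matrix (Fin n) (Fin n) ℝ) := by
    funext i j
    simp [Matrix.one_apply, Pi.single_apply, eq_comm]
  exact (congrArg Matrix.det h).trans Matrix.det_one

/-- An alternating form is determined by its values on injective families of basis vectors; in top
degree these are the permutations of the basis, on which both sides change by the same sign. -/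
theorem top_form_eq (A : (Fin n → ℝ) [⋀^Fin n]→L[ℝ] ℝ) :
    A = A (fun i => Pi.single i 1) • baseVol n := by
  apply ContinuousAlternatingMap.toAlternatingMap_injective
  refine Module.Basis.ext_alternating (Pi.basisFun ℝ (Fin n)) fun v hv => ?_
  obtain ⟨σ, rfl⟩ : ∃ σ : Equiv.Perm (Fin n), v = σ :=
    ⟨Equiv.ofBijective v (Finite.injective_iff_bijective.1 hv), rfl⟩
  have h1 := A.toAlternatingMap.map_perm (fun i => Pi.single i (1 : ℝ)) σ
  have h2 := (baseVol n).toAlternatingMap.map_perm (fun i => Pi.single i (1 : ℝ)) σ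
  have h3 : (baseVol n).toAlternatingMap (fun i => Pi.single i (1 : ℝ)) = 1 := baseVol_single
  have h4 : (A (fun i => Pi.single i 1) • baseVol n).toAlternatingMap =
    A (fun i => Pi.single i 1) • (baseVol n).toAlternatingMap := rfl
  rw [h3] at h2
  simp only [Pi.basisFun_apply, h4, AlternatingMap.smul_apply]
  refine h1.trans ?_
  erw [h2]
  simp [Units.smul_def, mul_comm]

theorem wedge_proj_baseVol (i : Fin n) :
    wedge (ContinuousLinearMap.proj (R := ℝ) (φ := fun _ : Fin n => ℝ) i) (baseVol n) = 0 := by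
  ext v
  refine AlternatingMap.map_linearDependent (wedge _ (baseVol n)).toAlternatingMap v fun h => ?_
  simpa using h.fintype_card_le_finrank

/-- Contract `dx^k ∧ ω_0 = 0` with `∂_i`. -/
theorem wedge_proj_baseVol1 (k i : Fin (n + 1)) :
    wedge (ContinuousLinearMap.proj (R := ℝ) (φ := fun _ : Fin (n + 1) => ℝ) k) (baseVol1 i) =
      (if k = i then (1 : ℝ) else 0) • baseVol (n + 1) := by
  have h := curryLeft_wedge (ContinuousLinearMap.proj (R := ℝ) (φ := fun _ : Fin (n + 1) => ℝ) k)
    (baseVol (n + 1)) (Pi.single i 1)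
  rw [wedge_proj_baseVol] at h
  have h' : (0 : (Fin (n + 1) → ℝ) [⋀^Fin (n + 1)]→L[ℝ] ℝ) = (if k = i then (1 : ℝ) else 0) •
      baseVol (n + 1) - wedge (ContinuousLinearMap.proj k) (baseVol1 i) := by
    rw [← show (0 : (Fin (n + 1) → ℝ) [⋀^Fin (n + 1 + 1)]→L[ℝ] ℝ).curryLeft (Pi.single i 1) = 0 from rfl, h]
    simp [wedgeInterior, baseVol1, Pi.single_apply]
  exact (sub_eq_zero.1 h'.symm).symm

/-- The components of an `n`-form on `ℝ^{n+1}` with respect to the forms `baseVol1 i`. -/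
def baseComp (i : Fin (n + 1)) (μ : (Fin (n + 1) → ℝ) [⋀^Fin n]→L[ℝ] ℝ) : ℝ :=
  wedge (ContinuousLinearMap.proj (R := ℝ) (φ := fun _ : Fin (n + 1) => ℝ) i) μ
    fun j => Pi.single j 1

theorem contDiff_baseComp (i : Fin (n + 1)) : ContDiff ℝ ∞ (baseComp (n := n) i) :=
  ((ContinuousAlternatingMap.apply ℝ (Fin (n + 1) → ℝ) ℝ (fun j => Pi.single j (1 : ℝ))).comp
    (wedgeCLM (Fin (n + 1) → ℝ) n (ContinuousLinearMap.proj i))).contDiff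

/-- The form `dx^i ∧ μ` has top degree, hence equals its component times `baseVol`; contraction with
`∂_i` gives `μ - dx^i ∧ i_{∂_i} μ`. Summed over `i` this is `(n + 1) μ - n μ`. -/
theorem sum_baseComp (μ : (Fin (n + 1) → ℝ) [⋀^Fin n]→L[ℝ] ℝ) :
    μ = ∑ i, baseComp i μ • baseVol1 i := by
  have h1 : ∀ i, baseComp i μ • baseVol1 i =
      μ - wedgeInterior (ContinuousLinearMap.proj i) (Pi.single i 1) μ := by
    intro i
    have h := curryLeft_wedge
      (ContinuousLinearMap.proj (R := ℝ) (φ := fun _ : Fin (n + 1) => ℝ) i) μ (Pi.single i 1)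
    rw [top_form_eq (wedge _ μ)] at h
    simpa [baseComp, baseVol1] using h
  -- The operator `∑ dx^i ∧ i_{∂_i}` multiplies a form by its degree, which is `n` here; in degree
  -- zero both sides vanish.
  have h2 : ∑ i, wedgeInterior (ContinuousLinearMap.proj i) (Pi.single i 1) μ = (n : ℝ) • μ := by
    cases n with
    | zero => simp [wedgeInterior]
    | succ n =>
      have h3 : μ.curryLeft = ∑ i, (ContinuousLinearMap.proj (R := ℝ)
          (φ := fun _ : Fin (n + 1 + 1) => ℝ) i).smulRight (μ.curryLeft (Pi.single i 1)) := by
        refine ContinuousLinearMap.ext fun x => ?_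
        conv_lhs => rw [pi_eq_sum_univ' x]
        simp
      have h4 := ContinuousAlternatingMap.alternatizeUncurryFin_curryLeft μ
      rw [h3, ← ContinuousAlternatingMap.alternatizeUncurryFinCLM_apply, map_sum] at h4
      rw [← Nat.cast_smul_eq_nsmul ℝ] at h4
      push_cast at h4 ⊢
      exact h4
  rw [Finset.sum_congr rfl fun i _ => h1 i, Finset.sum_sub_distrib, h2]
  simp only [Finset.sum_const, Finset.card_univ, Fintype.card_fin]
  rw [← Nat.cast_smul_eq_nsmul ℝ]
  push_cast
  module

theorem extDeriv_sum_baseVol1 {m : Fin (n + 1) → (Fin (n + 1) → ℝ) → ℝ} {x : Fin (n + 1) → ℝ}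
    (hm : ∀ i, DifferentiableAt ℝ (m i) x) :
    extDeriv (fun x => ∑ i, m i x • baseVol1 i) x =
      (∑ i, fderiv ℝ (m i) x (Pi.single i 1)) • baseVol (n + 1) := by
  rw [extDeriv_sum _ fun i _ => (hm i).smul_const _, Finset.sum_smul]
  refine Finset.sum_congr rfl fun i _ => ?_
  rw [extDeriv_smul_const (hm i)]
  have : fderiv ℝ (m i) x = ∑ k, fderiv ℝ (m i) x (Pi.single k 1) •
      ContinuousLinearMap.proj (R := ℝ) (φ := fun _ : Fin (n + 1) => ℝ) k := by
    refine ContinuousLinearMap.ext fun v => ?_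
    conv_lhs => rw [pi_eq_sum_univ' v]
    simp [mul_comm]
  conv_lhs => rw [this]
  simp [wedge_sum_left, wedge_smul_left, wedge_proj_baseVol1]

end Base

/-! ### Jet coordinates -/

section JetBasics

variable {n m r s k : ℕ} {V : Set ((Fin n → ℝ) × (Fin m → ℝ))}

theorem isOpen_jetSet (hV : IsOpen V) (r : ℕ) : IsOpen (jetSet (n := n) (m := m) V r) :=
  hV.preimage (by fun_prop)

theorem jetProj_mem (h : s ≤ r) {z : Jet n m r} (hz : z ∈ jetSet V r) : jetProj h z ∈ jetSet V s :=
  hz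

theorem fibreScale_apply (t : ℝ) (z : Jet n m r) : fibreScale t z = (z.1, t • z.2) := rfl

theorem fibreScale_mem (hstar : VerticallyStarShaped V) {z : Jet n m r} (hz : z ∈ jetSet V r)
    {t : ℝ} (ht : t ∈ Icc (0 : ℝ) 1) : fibreScale t z ∈ jetSet V r :=
  hstar _ hz t ht

theorem jetProj_fibreScale (h : s ≤ r) (t : ℝ) (z : Jet n m r) :
    jetProj h (fibreScale t z) = fibreScale t (jetProj h z) := rfl

theorem curryLeft_comp_baseProj (β : (Fin n → ℝ) [⋀^Fin (k + 1)]→L[ℝ] ℝ) (w : Jet n m r) :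
    (β.compContinuousLinearMap baseProj).curryLeft w =
      (β.curryLeft w.1).compContinuousLinearMap baseProj := by
  ext v
  simp only [ContinuousAlternatingMap.curryLeft_apply_apply,
    ContinuousAlternatingMap.compContinuousLinearMap_apply]
  congr 1
  funext j
  refine Fin.cases rfl (fun j => rfl) j

theorem curryLeft_comp_baseProj_vertical (β : (Fin n → ℝ) [⋀^Fin (k + 1)]→L[ℝ] ℝ)
    (w : Fin m → MultiIdx n r → ℝ) :
    (β.compContinuousLinearMap (baseProj (m := m) (r := r))).curryLeft (0, w) = 0 := by
  rw [curryLeft_comp_baseProj]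
  simp
  rfl

theorem omega1_eq (i : Fin (n + 1)) : (omega1 i : Jet (n + 1) m r [⋀^Fin n]→L[ℝ] ℝ) =
    (baseVol1 i).compContinuousLinearMap baseProj :=
  curryLeft_comp_baseProj _ _

theorem comp_baseProj_comp {E : Type} [NormedAddCommGroup E] [NormedSpace ℝ E]
    (β : (Fin n → ℝ) [⋀^Fin k]→L[ℝ] ℝ) (g : E →L[ℝ] Jet n m r) :
    (β.compContinuousLinearMap baseProj).compContinuousLinearMap g =
      β.compContinuousLinearMap (baseProj.comp g) := rfl

theorem omega0_comp {g : Jet n m s →L[ℝ] Jet n m r} (hg : baseProj.comp g = baseProj) :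
    (omega0 : Jet n m r [⋀^Fin n]→L[ℝ] ℝ).compContinuousLinearMap g = omega0 := by
  rw [omega0, comp_baseProj_comp, hg, omega0]

theorem omega1_comp {g : Jet (n + 1) m s →L[ℝ] Jet (n + 1) m r} (hg : baseProj.comp g = baseProj)
    (i : Fin (n + 1)) :
    (omega1 i : Jet (n + 1) m r [⋀^Fin n]→L[ℝ] ℝ).compContinuousLinearMap g = omega1 i := by
  rw [omega1_eq, comp_baseProj_comp, hg, omega1_eq]

theorem omega0_dX : (omega0 : Jet n m r [⋀^Fin n]→L[ℝ] ℝ) (fun i => dX i) = 1 :=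
  baseVol_single

theorem wedge_dxForm_omega1 (k i : Fin (n + 1)) :
    wedge (dxForm k) (omega1 i : Jet (n + 1) m r [⋀^Fin n]→L[ℝ] ℝ) =
      (if k = i then (1 : ℝ) else 0) • omega0 := by
  have h := congrArg (fun A => ContinuousAlternatingMap.compContinuousLinearMap A
    (baseProj (n := n + 1) (m := m) (r := r))) (wedge_proj_baseVol1 k i)
  simp only [wedge_comp] at h
  rw [omega1_eq]
  exact h

/-- Contract `dx^k ∧ ω_i = δ^k_i ω_0` with `∂_j`. For a one-dimensional base the two terms on the
right cancel, in agreement with `ω_{ij} = 0`. -/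
theorem wedgeInterior_dxForm_omega1 (k i j : Fin (n + 1)) :
    wedgeInterior (dxForm k) (dX j) (omega1 i : Jet (n + 1) m r [⋀^Fin n]→L[ℝ] ℝ) =
      (if k = j then (1 : ℝ) else 0) • omega1 i - (if k = i then (1 : ℝ) else 0) • omega1 j := by
  have h := curryLeft_wedge (dxForm k) (omega1 i : Jet (n + 1) m r [⋀^Fin n]→L[ℝ] ℝ) (dX j)
  rw [wedge_dxForm_omega1] at h
  have h2 : dxForm k (dX j : Jet (n + 1) m r) = if k = j then (1 : ℝ) else 0 := by
    simp [dxForm, baseProj, dX, Pi.single_apply]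
  rw [h2] at h
  rw [eq_sub_iff_add_eq, ← eq_sub_iff_add_eq', ← h]
  rfl

/-- The linear part of the affine map `totalVec i`. -/
def totalLin (i : Fin n) : Jet n m (r + 1) →L[ℝ] Jet n m r where
  toFun z := (0, fun σ J => z.2 σ ⟨i ::ₘ J.1, by simpa using J.2⟩)
  map_add' _ _ := by ext <;> simp
  map_smul' _ _ := by ext <;> simp
  cont := by fun_prop

theorem totalVec_eq (i : Fin n) (z : Jet n m (r + 1)) : totalVec i z = dX i + totalLin i z := by
  simp [totalVec, dX, totalLin]

theorem totalVec_eq_fun (i : Fin n) :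
    (totalVec i : Jet n m (r + 1) → Jet n m r) = fun z => dX i + totalLin i z :=
  funext (totalVec_eq i)

theorem vertical_eq_sum (w : Fin m → MultiIdx n r → ℝ) :
    ((0, w) : Jet n m r) = ∑ σ, ∑ J, w σ J • dY σ J := by
  refine Prod.ext ?_ ?_
  · simp [dY, Prod.fst_sum]
  · funext σ J
    simp [dY, Prod.snd_sum, Finset.sum_apply, Pi.single_apply, apply_ite, ite_apply]

theorem horPart_apply (z v : Jet n m (r + 1)) : horPart z v = ∑ i, v.1 i • totalVec i z := by
  simp [horPart, dxForm, baseProj]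

theorem baseProj_comp_horPart (z : Jet n m (r + 1)) : baseProj.comp (horPart z) = baseProj := by
  refine ContinuousLinearMap.ext fun v => ?_
  funext j
  simp [horPart_apply, baseProj, totalVec, Finset.sum_apply, Pi.single_apply]

theorem baseProj_comp_contactPart (z : Jet n m (r + 1)) :
    baseProj.comp (contactPart z) = 0 := by
  rw [contactPart, ContinuousLinearMap.comp_sub, baseProj_comp_horPart]
  refine ContinuousLinearMap.ext fun v => ?_
  exact sub_self _

theorem comp_horPart (f : Jet n m r →L[ℝ] ℝ) (z : Jet n m (r + 1)) :
    f.comp (horPart z) = ∑ i, f (totalVec i z) • dxForm i := by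
  refine ContinuousLinearMap.ext fun v => ?_
  simp [horPart_apply, dxForm, baseProj, mul_comm]

theorem dxForm_comp_contactPart (i : Fin n) (z : Jet n m (r + 1)) :
    (dxForm i).comp (contactPart z) = 0 := by
  rw [dxForm, ContinuousLinearMap.comp_assoc, baseProj_comp_contactPart,
    ContinuousLinearMap.comp_zero]

theorem dxForm_comp_horPart (i : Fin n) (z : Jet n m (r + 1)) :
    (dxForm i).comp (horPart z) = dxForm i := by
  rw [dxForm, ContinuousLinearMap.comp_assoc, baseProj_comp_horPart, dxForm]

theorem dyForm_comp_contactPart (σ : Fin m) (J : MultiIdx n r) (z : Jet n m (r + 1)) :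
    (dyForm σ J).comp (contactPart z) = contactForm σ J.1 (by simpa using J.2) z := by
  refine ContinuousLinearMap.ext fun v => ?_
  have h : dyForm σ J (horPart z v) = ∑ i, v.1 i * dyForm σ J (totalVec i z) := by
    rw [horPart_apply, map_sum]
    simp
  simp only [ContinuousLinearMap.comp_apply, contactPart, sub_apply, map_sub, h,
    contactForm]
  simp [dxForm, baseProj, dyForm, totalVec, jetProj, mul_comm]

theorem contact0_comp_contactPart (σ : Fin m) (z : Jet n m (r + 2)) :
    (contact0 σ (jetProj (r + 1).le_succ z)).comp (contactPart z) = contact0 σ z := by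
  rw [contact0, contactForm, ContinuousLinearMap.sub_comp, dyForm_comp_contactPart]
  rw [ContinuousLinearMap.finsetSum_comp, Finset.sum_eq_zero, sub_zero]
  · rfl
  · intro j _
    rw [ContinuousLinearMap.smul_comp, dxForm_comp_contactPart, smul_zero]

theorem contact0_comp_horPart (σ : Fin m) (z : Jet n m (r + 2)) :
    (contact0 σ (jetProj (r + 1).le_succ z)).comp (horPart z) = 0 := by
  rw [contact0, contactForm, ContinuousLinearMap.sub_comp, comp_horPart,
    ContinuousLinearMap.finsetSum_comp, sub_eq_zero]
  refine Finset.sum_congr rfl fun j _ => ?_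
  rw [ContinuousLinearMap.smul_comp, dxForm_comp_horPart]
  rfl

theorem sum_multiIdx_one {M : Type*} [AddCommMonoid M] (g : MultiIdx n 1 → M) :
    ∑ J, g J = g ⟨0, by simp⟩ + ∑ j, g ⟨{j}, by simp⟩ := by
  let e : Option (Fin n) → MultiIdx n 1 := fun o =>
    o.elim ⟨0, by simp⟩ fun j => ⟨{j}, by simp⟩
  have he : Function.Bijective e := by
    constructor
    · rintro (_ | i) (_ | j) h
      · rfl
      · exact absurd (congrArg Subtype.val h).symm (Multiset.singleton_ne_zero j)
      · exact absurd (congrArg Subtype.val h) (Multiset.singleton_ne_zero i)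
      · exact congrArg some (Multiset.singleton_inj.1 (congrArg Subtype.val h))
    · rintro ⟨J, hJ⟩
      rcases Nat.le_one_iff_eq_zero_or_eq_one.1 hJ with h | h
      · exact ⟨none, Subtype.ext (Multiset.card_eq_zero.1 h).symm⟩
      · obtain ⟨j, rfl⟩ := Multiset.card_eq_one.1 h
        exact ⟨some j, rfl⟩
  rw [← he.sum_comp, Fintype.sum_option]
  rfl

/-- The contact part has vertical values, so a covector sees it only through its fibre components,
and the contact part of `dy^σ_J` is `ω^σ_J`. -/
theorem comp_contactPart_one (f : Jet n m 1 →L[ℝ] ℝ) (z : Jet n m 2) :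
    f.comp (contactPart z) = ∑ σ, (f (dY σ ⟨0, by simp⟩) • contact0 σ z
      + ∑ j, f (dY σ ⟨{j}, by simp⟩) • contact1 σ j z) := by
  refine ContinuousLinearMap.ext fun v => ?_
  have h0 : (contactPart z v).1 = 0 :=
    congrArg (fun L => L v) (baseProj_comp_contactPart z)
  have h1 : contactPart z v = (0, (contactPart z v).2) := Prod.ext h0 rfl
  have h2 : ∀ σ (J : MultiIdx n 1), (contactPart z v).2 σ J =
      contactForm σ J.1 (by simpa using J.2) z v := fun σ J =>
    congrArg (fun L => L v) (dyForm_comp_contactPart σ J z)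
  rw [ContinuousLinearMap.comp_apply, h1, vertical_eq_sum, map_sum]
  simp only [h2, sum_multiIdx_one]
  simp [contact0, contact1, mul_comm]

end JetBasics

/-! ### Smoothness -/

section Smoothness

variable {n m r : ℕ} {V : Set ((Fin n → ℝ) × (Fin m → ℝ))}

theorem contDiffOn_comp_jetProj {s : ℕ} (h : s ≤ r) {F : Type} [NormedAddCommGroup F]
    [NormedSpace ℝ F] {f : Jet n m s → F} (hf : ContDiffOn ℝ ∞ f (jetSet V s)) :
    ContDiffOn ℝ ∞ (fun z => f (jetProj h z)) (jetSet V r) :=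
  hf.comp (jetProj h).contDiff.contDiffOn fun _ hz => jetProj_mem h hz

theorem contDiffOn_fderiv_apply (hV : IsOpen V) {f : Jet n m r → ℝ}
    (hf : ContDiffOn ℝ ∞ f (jetSet V r)) (w : Jet n m r) :
    ContDiffOn ℝ ∞ (fun z => fderiv ℝ f z w) (jetSet V r) :=
  (hf.fderiv_of_isOpen (isOpen_jetSet hV r) (m := ∞) (by simp)).clm_apply contDiffOn_const

theorem contDiffOn_totalDeriv (hV : IsOpen V) {f : Jet n m r → ℝ}
    (hf : ContDiffOn ℝ ∞ f (jetSet V r)) (i : Fin n) :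
    ContDiffOn ℝ ∞ (totalDeriv i f) (jetSet V (r + 1)) := by
  refine (contDiffOn_comp_jetProj r.le_succ
    (hf.fderiv_of_isOpen (isOpen_jetSet hV r) (m := ∞) (by simp))).clm_apply ?_
  rw [totalVec_eq_fun]
  fun_prop

theorem differentiableAt_of_contDiffOn (hV : IsOpen V) {F : Type} [NormedAddCommGroup F]
    [NormedSpace ℝ F] {f : Jet n m r → F} (hf : ContDiffOn ℝ ∞ f (jetSet V r))
    {z : Jet n m r} (hz : z ∈ jetSet V r) : DifferentiableAt ℝ f z :=
  (hf.contDiffAt ((isOpen_jetSet hV r).mem_nhds hz)).differentiableAt (by simp)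

theorem contDiffOn_lagrangeFun {lam : Form (Jet n m r) n} (hlam : ContDiffOn ℝ ∞ lam (jetSet V r)) :
    ContDiffOn ℝ ∞ (lagrangeFun lam) (jetSet V r) :=
  (ContinuousAlternatingMap.apply ℝ (Jet n m r) ℝ (fun i => dX i)).contDiff.comp_contDiffOn hlam

/-- The mean value of `f` along the fibre scaling. -/
def scaleMean (f : Jet n m r → ℝ) (z : Jet n m r) : ℝ := ∫ t in (0 : ℝ)..1, f (fibreScale t z)

theorem contDiff_fibreScale : ContDiff ℝ ∞ fun p : ℝ × Jet n m r => fibreScale p.1 p.2 := by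
  simp only [fibreScale_apply]
  fun_prop

theorem contDiffOn_scaleMean (hV : IsOpen V) (hstar : VerticallyStarShaped V) {f : Jet n m r → ℝ}
    (hf : ContDiffOn ℝ ∞ f (jetSet V r)) : ContDiffOn ℝ ∞ (scaleMean f) (jetSet V r) :=
  contDiffOn_intervalIntegral (f := fun p : ℝ × Jet n m r => f (fibreScale p.1 p.2)) zero_le_one
    ((isOpen_jetSet hV r).preimage contDiff_fibreScale.continuous) (isOpen_jetSet hV r)
    (fun _ hz _ ht => fibreScale_mem hstar hz ht)
    (hf.comp contDiff_fibreScale.contDiffOn fun _ hp => hp)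

theorem continuousOn_fibreScale (hstar : VerticallyStarShaped V) {F : Type} [TopologicalSpace F]
    {f : Jet n m r → F} (hf : ContinuousOn f (jetSet V r)) {z : Jet n m r} (hz : z ∈ jetSet V r) :
    ContinuousOn (fun t => f (fibreScale t z)) (Icc 0 1) :=
  hf.comp ((contDiff_fibreScale.continuous.comp (by fun_prop : Continuous fun t : ℝ => (t, z)))
    |>.continuousOn) fun _ ht => fibreScale_mem hstar hz ht

theorem intervalIntegrable_fibreScale (hstar : VerticallyStarShaped V) {F : Type}
    [NormedAddCommGroup F] {f : Jet n m r → F} (hf : ContinuousOn f (jetSet V r))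
    {z : Jet n m r} (hz : z ∈ jetSet V r) :
    IntervalIntegrable (fun t => f (fibreScale t z)) volume 0 1 :=
  ContinuousOn.intervalIntegrable (by
    rw [uIcc_of_le zero_le_one]; exact continuousOn_fibreScale hstar hf hz)

/-- The linear map `χ_t` also acts on the direction `w`. It carries `totalVec` at `z` to `totalVec`
at `χ_t z`, which is why the mean commutes with total derivatives. -/
theorem fderiv_scaleMean (hV : IsOpen V) (hstar : VerticallyStarShaped V) {f : Jet n m r → ℝ}
    (hf : ContDiffOn ℝ ∞ f (jetSet V r)) {z : Jet n m r} (hz : z ∈ jetSet V r) (w : Jet n m r) :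
    fderiv ℝ (scaleMean f) z w =
      ∫ t in (0 : ℝ)..1, fderiv ℝ f (fibreScale t z) (fibreScale t w) := by
  have hW : IsOpen ((fun p : ℝ × Jet n m r => fibreScale p.1 p.2) ⁻¹' jetSet V r) :=
    (isOpen_jetSet hV r).preimage contDiff_fibreScale.continuous
  have hF : ContDiffOn ℝ ∞ (fun p : ℝ × Jet n m r => f (fibreScale p.1 p.2))
      ((fun p : ℝ × Jet n m r => fibreScale p.1 p.2) ⁻¹' jetSet V r) :=
    hf.comp contDiff_fibreScale.contDiffOn fun _ hp => hp
  have hmem : ∀ t ∈ Icc (0 : ℝ) 1,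
      (t, z) ∈ (fun p : ℝ × Jet n m r => fibreScale p.1 p.2) ⁻¹' jetSet V r :=
    fun t ht => fibreScale_mem hstar hz ht
  have h1 : HasFDerivAt (scaleMean f) _ z :=
    hasFDerivAt_intervalIntegral zero_le_one hW (hF.of_le (by norm_cast)) hmem
  rw [h1.fderiv, ContinuousLinearMap.intervalIntegral_apply]
  · refine intervalIntegral.integral_congr fun t ht => ?_
    rw [uIcc_of_le zero_le_one] at ht
    have e1 := ((hF.contDiffAt (hW.mem_nhds (hmem t ht))).differentiableAt
      (by simp)).hasFDerivAt.comp z (hasFDerivAt_prodMk_right t z)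
    have e2 := (differentiableAt_of_contDiffOn hV hf
      (fibreScale_mem hstar hz ht)).hasFDerivAt.comp z (fibreScale t).hasFDerivAt
    exact congrArg (fun L => L w) (e1.unique e2)
  · refine intervalIntegrable_slice (f := fun p => (fderiv ℝ
      (fun p : ℝ × Jet n m r => f (fibreScale p.1 p.2)) p).comp
      (ContinuousLinearMap.inr ℝ ℝ (Jet n m r))) zero_le_one ?_ hmem
    exact (hF.continuousOn_fderiv_of_isOpen hW (by norm_cast)).clm_comp continuousOn_const

/-- The fundamental theorem of calculus along the fibre scaling. -/
theorem integral_fderiv_fibreScale (hV : IsOpen V) (hstar : VerticallyStarShaped V)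
    {f : Jet n m r → ℝ} (hf : ContDiffOn ℝ ∞ f (jetSet V r)) {z : Jet n m r}
    (hz : z ∈ jetSet V r) :
    ∫ t in (0 : ℝ)..1, fderiv ℝ f (fibreScale t z) (0, z.2) = f z - f (z.1, 0) := by
  have hderiv : ∀ t ∈ uIcc (0 : ℝ) 1, HasDerivAt (fun t => f (fibreScale t z))
      (fderiv ℝ f (fibreScale t z) (0, z.2)) t := by
    intro t ht
    rw [uIcc_of_le zero_le_one] at ht
    refine (differentiableAt_of_contDiffOn hV hf
      (fibreScale_mem hstar hz ht)).hasFDerivAt.comp_hasDerivAt t ?_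
    have h2 : HasDerivAt (fun t : ℝ => t • z.2) z.2 t := by
      simpa using (hasDerivAt_id t).smul_const z.2
    exact (hasDerivAt_const t z.1).prodMk h2
  rw [intervalIntegral.integral_eq_sub_of_hasDerivAt hderiv]
  · simp [fibreScale_apply]
  · refine intervalIntegrable_fibreScale (f := fun y => fderiv ℝ f y (0, z.2)) hstar ?_ hz
    exact (contDiffOn_fderiv_apply hV hf _).continuousOn

end Smoothness

/-! ### Components of `α`, the Vainberg-Tonti Lagrangian and the decomposition of `λ`. -/

section Homotopy

variable {n m : ℕ} {V : Set ((Fin (n + 1) → ℝ) × (Fin m → ℝ))}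
  {lam : Form (Jet (n + 1) m 1) (n + 1)} {μ₀ : Form (Fin (n + 1) → ℝ) n}

/-- Horizontality lets each argument be replaced by the zero-section lift of its base projection,
since the difference is vertical. The form is then pulled back from a top form on the base. -/
theorem horizontal_eq (hhor : IsHorizontal V lam) {z : Jet (n + 1) m 1} (hz : z ∈ jetSet V 1) :
    lam z = lagrangeFun lam z • omega0 := by
  let lift : (Fin (n + 1) → ℝ) →L[ℝ] Jet (n + 1) m 1 := zeroSection
  have hlift : ∀ v, lam z v = lam z fun i => lift (baseProj (v i)) := by
    intro v
    -- The arguments are exchanged one at a time, by induction on the set of those already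
    -- exchanged.
    have key : ∀ s : Finset (Fin (n + 1)),
        lam z (fun i => if i ∈ s then lift (baseProj (v i)) else v i) = lam z v := by
      intro s
      induction s using Finset.induction_on with
      | empty => simp
      | insert a s ha ih =>
        rw [← ih]
        set u : Fin (n + 1) → Jet (n + 1) m 1 :=
          fun i => if i ∈ s then lift (baseProj (v i)) else v i
        have h1 : (fun i => if i ∈ insert a s then lift (baseProj (v i)) else v i) =
            Function.update u a (lift (baseProj (v a))) := by
          funext i
          by_cases hi : i = a
          · subst hi; simp
          · simp [u, hi]
        have h2 : u = Function.update u a (v a) := by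
          have : u a = v a := by simp [u, ha]
          rw [← this, Function.update_eq_self]
        rw [h1]
        conv_rhs => rw [h2]
        rw [← sub_eq_zero, ← ContinuousAlternatingMap.map_update_sub]
        refine hhor z hz _ ⟨a, ?_⟩
        simp [lift, baseProj, zeroSection]
    simpa using (key Finset.univ).symm
  have htop := top_form_eq ((lam z).compContinuousLinearMap lift)
  ext v
  rw [hlift]
  exact congrArg (fun A => A fun i => baseProj (v i)) htop

theorem wedge_contact0_curryLeft_vertical {k r : ℕ} (σ : Fin m) (z : Jet (n + 1) m (r + 1))
    (w : Fin m → MultiIdx (n + 1) (r + 1) → ℝ) (β : (Fin (n + 1) → ℝ) [⋀^Fin k]→L[ℝ] ℝ) :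
    (wedge (contact0 σ z) (β.compContinuousLinearMap baseProj)).curryLeft (0, w) =
      w σ ⟨0, Nat.zero_le _⟩ • β.compContinuousLinearMap baseProj := by
  have h0 : contact0 σ z (0, w) = w σ ⟨0, Nat.zero_le _⟩ := by
    simp [contact0, contactForm, dyForm, dxForm, baseProj]
  rw [curryLeft_wedge, h0]
  cases k with
  | zero => simp [wedgeInterior]
  | succ k =>
    rw [wedgeInterior_of_curryLeft_eq_zero _ _ _ (curryLeft_comp_baseProj_vertical β w), sub_zero]

theorem intervalIntegrable_sum {ι : Type*} (s : Finset ι) {f : ι → ℝ → ℝ} {a b : ℝ}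
    (h : ∀ i ∈ s, IntervalIntegrable (f i) volume a b) :
    IntervalIntegrable (fun t => ∑ i ∈ s, f i t) volume a b := by
  have h1 : (fun t => ∑ i ∈ s, f i t) = ∑ i ∈ s, f i := by
    funext t
    rw [Finset.sum_apply]
  rw [h1]
  exact IntervalIntegrable.sum s h

/-- The interior product with `X`, as a linear map. -/
def interior {E : Type} [NormedAddCommGroup E] [NormedSpace ℝ E] {k : ℕ} (X : E) :
    E [⋀^Fin (k + 1)]→L[ℝ] ℝ →ₗ[ℝ] E [⋀^Fin k]→L[ℝ] ℝ where
  toFun η := η.curryLeft X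
  map_add' _ _ := rfl
  map_smul' _ _ := rfl

theorem interior_apply {E : Type} [NormedAddCommGroup E] [NormedSpace ℝ E] {k : ℕ} (X : E)
    (η : E [⋀^Fin (k + 1)]→L[ℝ] ℝ) : interior X η = η.curryLeft X := rfl

/-- The scaling fixes the base, so the pullback along `χ_t` leaves base forms unchanged and only the
coefficients are integrated. -/
theorem homotopyOp_eq {ι : Type*} [Fintype ι] {k r : ℕ} {ρ : Form (Jet (n + 1) m r) (k + 1)}
    {z : Jet (n + 1) m r} (c : ι → ℝ → ℝ) (β : ι → (Fin (n + 1) → ℝ) [⋀^Fin k]→L[ℝ] ℝ)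
    (hc : ∀ i, IntervalIntegrable (c i) volume 0 1)
    (h : ∀ t ∈ Icc (0 : ℝ) 1, (ρ (fibreScale t z)).curryLeft (0, z.2) =
      ∑ i, c i t • (β i).compContinuousLinearMap baseProj) :
    homotopyOp ρ z =
      ∑ i, (∫ t in (0 : ℝ)..1, c i t) • (β i).compContinuousLinearMap baseProj := by
  have h1 : homotopyOp ρ z =
      ∫ t in (0 : ℝ)..1, ∑ i, c i t • (β i).compContinuousLinearMap baseProj := by
    refine intervalIntegral.integral_congr fun t ht => ?_
    rw [uIcc_of_le zero_le_one] at ht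
    simp only [h t ht]
    ext v
    simp only [ContinuousAlternatingMap.compContinuousLinearMap_apply,
      ContinuousAlternatingMap.sum_apply, ContinuousAlternatingMap.smul_apply]
    rfl
  rw [h1, intervalIntegral.integral_finsetSum]
  · simp only [intervalIntegral.integral_smul_const]
  · exact fun i _ => (hc i).smul_continuousOn continuousOn_const

/-- The components `α^i` of the form `α`. -/
def alphaComp (lam : Form (Jet (n + 1) m 1) (n + 1)) (μ₀ : Form (Fin (n + 1) → ℝ) n)
    (i : Fin (n + 1)) (z : Jet (n + 1) m 1) : ℝ :=
  (∑ σ, z.2 σ ⟨0, Nat.zero_le _⟩ * scaleMean (pderiv1 σ i (lagrangeFun lam)) z)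
    + baseComp i (μ₀ z.1)

theorem contDiffOn_pderiv1_lagrangeFun (hV : IsOpen V) (hsmooth : ContDiffOn ℝ ∞ lam (jetSet V 1))
    (σ : Fin m) (i : Fin (n + 1)) :
    ContDiffOn ℝ ∞ (pderiv1 σ i (lagrangeFun lam)) (jetSet V 1) :=
  contDiffOn_fderiv_apply hV (contDiffOn_lagrangeFun hsmooth) _

theorem fst_mem_image {r : ℕ} {z : Jet (n + 1) m r} (hz : z ∈ jetSet V r) : z.1 ∈ Prod.fst '' V :=
  ⟨_, hz, rfl⟩

theorem contDiffOn_alphaComp (hV : IsOpen V) (hstar : VerticallyStarShaped V)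
    (hsmooth : ContDiffOn ℝ ∞ lam (jetSet V 1)) (hμ : ContDiffOn ℝ ∞ μ₀ (Prod.fst '' V))
    (i : Fin (n + 1)) : ContDiffOn ℝ ∞ (alphaComp lam μ₀ i) (jetSet V 1) := by
  refine ContDiffOn.add (ContDiffOn.sum fun σ _ => ContDiffOn.mul (by fun_prop)
    (contDiffOn_scaleMean hV hstar (contDiffOn_pderiv1_lagrangeFun hV hsmooth σ i))) ?_
  exact (contDiff_baseComp i).comp_contDiffOn
    (hμ.comp contDiff_fst.contDiffOn fun _ hz => fst_mem_image hz)

/-- The vertical vector `(0, z.2)` annihilates `ω_0` and `ω_i` and pairs with `ω^σ` to `y^σ`, so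
only the momenta `∂L/∂y^σ_i` enter. -/
theorem alphaForm_eq (hV : IsOpen V) (hstar : VerticallyStarShaped V)
    (hsmooth : ContDiffOn ℝ ∞ lam (jetSet V 1)) {z : Jet (n + 1) m 1} (hz : z ∈ jetSet V 1) :
    alphaForm lam μ₀ z = ∑ i, alphaComp lam μ₀ i z • omega1 i := by
  have hp := fun σ i => (contDiffOn_pderiv1_lagrangeFun hV hsmooth σ i).continuousOn
  have h1 : homotopyOp (Theta1 lam) z = ∑ i, (∫ t in (0 : ℝ)..1, ∑ σ,
      z.2 σ ⟨0, Nat.zero_le _⟩ * pderiv1 σ i (lagrangeFun lam) (fibreScale t z)) •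
        (baseVol1 i).compContinuousLinearMap baseProj := by
    refine homotopyOp_eq _ _ (fun i => ?_) fun t _ => ?_
    · refine intervalIntegrable_sum _ fun σ _ => ?_
      exact (intervalIntegrable_fibreScale hstar (hp σ i) hz).const_mul _
    · have e0 : interior (0, z.2) (omega0 : Jet (n + 1) m 1 [⋀^Fin (n + 1)]→L[ℝ] ℝ) = 0 :=
        curryLeft_comp_baseProj_vertical _ _
      have e1 : ∀ σ i, interior (0, z.2) (wedge (contact0 σ (fibreScale t z)) (omega1 i)) =
          z.2 σ ⟨0, Nat.zero_le _⟩ • (baseVol1 i).compContinuousLinearMap baseProj := by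
        intro σ i
        rw [omega1_eq]
        exact wedge_contact0_curryLeft_vertical σ _ _ _
      rw [← interior_apply]
      simp only [Theta1, map_add, map_sum, map_smul, e0, e1, smul_zero, zero_add, Finset.sum_smul]
      rw [Finset.sum_comm]
      simp only [smul_smul, mul_comm]
  rw [alphaForm, h1, pull, sum_baseComp (μ₀ (baseProj z))]
  have h2 : (∑ i, baseComp i (μ₀ (baseProj z)) • baseVol1 i).compContinuousLinearMap
      (baseProj (m := m) (r := 1)) = ∑ i, baseComp i (μ₀ z.1) • omega1 i := by
    simp only [omega1_eq]
    ext v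
    simp [ContinuousAlternatingMap.sum_apply]
    rfl
  rw [h2, ← Finset.sum_add_distrib]
  refine Finset.sum_congr rfl fun i _ => ?_
  rw [← omega1_eq, ← add_smul, alphaComp, intervalIntegral.integral_finsetSum]
  · simp only [intervalIntegral.integral_const_mul, scaleMean]
  · exact fun σ _ => (intervalIntegrable_fibreScale hstar (hp σ i) hz).const_mul _

theorem contDiffOn_eulerLagrange (hV : IsOpen V) (hsmooth : ContDiffOn ℝ ∞ lam (jetSet V 1))
    (σ : Fin m) : ContDiffOn ℝ ∞ (eulerLagrange lam σ) (jetSet V 2) :=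
  (contDiffOn_comp_jetProj _ (contDiffOn_fderiv_apply hV (contDiffOn_lagrangeFun hsmooth) _)).sub
    (ContDiffOn.sum fun i _ =>
      contDiffOn_totalDeriv hV (contDiffOn_pderiv1_lagrangeFun hV hsmooth σ i) i)

theorem vainbergTonti_eq (hV : IsOpen V) (hstar : VerticallyStarShaped V)
    (hsmooth : ContDiffOn ℝ ∞ lam (jetSet V 1)) {z : Jet (n + 1) m 2} (hz : z ∈ jetSet V 2) :
    vainbergTonti lam z = (∫ t in (0 : ℝ)..1, ∑ σ,
      z.2 σ ⟨0, Nat.zero_le _⟩ * eulerLagrange lam σ (fibreScale t z)) • omega0 := by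
  have h := homotopyOp_eq (ρ := eulerLagrangeForm lam) (z := z) (ι := Unit) (fun _ t => ∑ σ,
      z.2 σ ⟨0, Nat.zero_le _⟩ * eulerLagrange lam σ (fibreScale t z))
    (fun _ => baseVol (n + 1)) (fun _ => ?_) fun t _ => ?_
  · rw [vainbergTonti, h]
    simp [omega0]
  · exact intervalIntegrable_sum _ fun σ _ => (intervalIntegrable_fibreScale hstar
      (contDiffOn_eulerLagrange hV hsmooth σ).continuousOn hz).const_mul _
  · have e1 : ∀ σ, interior (0, z.2) (wedge (contact0 σ (fibreScale t z)) omega0) =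
        z.2 σ ⟨0, Nat.zero_le _⟩ • (baseVol (n + 1)).compContinuousLinearMap baseProj :=
      fun σ => wedge_contact0_curryLeft_vertical σ _ _ _
    rw [← interior_apply]
    simp only [eulerLagrangeForm, map_sum, map_smul, e1]
    simp [Finset.sum_smul, smul_smul, mul_comm]

theorem zeroSection_mem (hstar : VerticallyStarShaped V) {r : ℕ} {x : Fin (n + 1) → ℝ}
    (hx : x ∈ Prod.fst '' V) : (zeroSection x : Jet (n + 1) m r) ∈ jetSet V r := by
  obtain ⟨p, hp, rfl⟩ := hx
  have := hstar p hp 0 ⟨le_rfl, zero_le_one⟩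
  rwa [zero_smul] at this

/-- All fibre coordinates, the derivative ones included, vanish along the zero section, so it pulls
every `ω^σ` back to zero. -/
theorem pull_zeroSection_Theta1 (lam : Form (Jet (n + 1) m 1) (n + 1)) (x : Fin (n + 1) → ℝ) :
    pull zeroSection (Theta1 lam) x = lagrangeFun lam (zeroSection x) • baseVol (n + 1) := by
  have h0 : ∀ σ : Fin m, (contact0 σ (zeroSection x : Jet (n + 1) m 1)).comp zeroSection = 0 := by
    intro σ
    refine ContinuousLinearMap.ext fun v => ?_
    simp [contact0, contactForm, dyForm, zeroSection]
  have h1 : ∀ (σ : Fin m) (i : Fin (n + 1)),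
      (wedge (contact0 σ (zeroSection x : Jet (n + 1) m 1))
        (omega1 i)).compContinuousLinearMap zeroSection = 0 := by
    intro σ i
    rw [wedge_comp, h0, wedge_zero_left]
  have h1' := fun σ i v => congrArg (fun A => A v) (h1 σ i)
  ext v
  simp only [ContinuousAlternatingMap.compContinuousLinearMap_apply] at h1'
  simp only [pull, Theta1, ContinuousAlternatingMap.compContinuousLinearMap_apply,
    ContinuousAlternatingMap.add_apply, ContinuousAlternatingMap.sum_apply,
    ContinuousAlternatingMap.smul_apply, h1']
  simp [omega0]
  left
  rfl

theorem isOpen_image_fst (hV : IsOpen V) : IsOpen (Prod.fst '' V) := isOpenMap_fst V hV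

/-- Top-degree forms on open subsets of the base are exact. -/
theorem exists_isBasePrimitive (hV : IsOpen V) (hstar : VerticallyStarShaped V)
    (hsmooth : ContDiffOn ℝ ∞ lam (jetSet V 1)) : ∃ μ₀, IsBasePrimitive V lam μ₀ := by
  -- The equation `d μ₀ = 0^* Θ_λ` becomes `div X = L(x, 0)`, solvable without any condition on the
  -- shape of the base domain.
  obtain ⟨X, hX, hXd⟩ := exists_diver_eq (isOpen_image_fst hV)
    (f := fun x => lagrangeFun lam (zeroSection x))
    ((contDiffOn_lagrangeFun hsmooth).comp zeroSection.contDiff.contDiffOn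
      fun x hx => zeroSection_mem hstar hx)
  have hXi : ∀ i, ContDiffOn ℝ ∞ (fun x => X x i) (Prod.fst '' V) := fun i =>
    contDiffOn_pi.1 hX i
  refine ⟨fun x => ∑ i, X x i • baseVol1 i,
    ContDiffOn.sum fun i _ => (hXi i).smul contDiffOn_const, fun x hx => ?_⟩
  have hnhds := (isOpen_image_fst hV).mem_nhds hx
  rw [extDeriv_sum_baseVol1 fun i => ((hXi i).contDiffAt hnhds).differentiableAt (by simp),
    pull_zeroSection_Theta1, ← hXd x hx, diver]
  congr 1
  refine Finset.sum_congr rfl fun i _ => ?_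
  have hd := ((hX.contDiffAt hnhds).differentiableAt (by simp)).hasFDerivAt
  rw [((hasFDerivAt_pi'.1 hd) i).fderiv]
  rfl

theorem sum_fderiv_baseComp (hV : IsOpen V) (hμ : IsBasePrimitive V lam μ₀)
    {x : Fin (n + 1) → ℝ} (hx : x ∈ Prod.fst '' V) :
    ∑ i, fderiv ℝ (fun x => baseComp i (μ₀ x)) x (Pi.single i 1) =
      lagrangeFun lam (zeroSection x) := by
  have hnhds := (isOpen_image_fst hV).mem_nhds hx
  have h1 := hμ.2 x hx
  have h2 : μ₀ = fun x => ∑ i, baseComp i (μ₀ x) • baseVol1 i := funext fun x => sum_baseComp _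
  have h3 : ∀ i, DifferentiableAt ℝ (fun x => baseComp i (μ₀ x)) x := fun i =>
    (((contDiff_baseComp i).comp_contDiffOn hμ.1).contDiffAt hnhds).differentiableAt (by simp)
  rw [h2, extDeriv_sum_baseVol1 h3, pull_zeroSection_Theta1] at h1
  have h4 := congrArg (fun A => A fun i => Pi.single i (1 : ℝ)) h1
  simpa [baseVol_single] using h4

/-- The product rule for `y^σ` times the mean of the momentum; the total derivative passes through
the scaling under the integral. -/
theorem totalDeriv_alphaComp (hV : IsOpen V) (hstar : VerticallyStarShaped V)
    (hsmooth : ContDiffOn ℝ ∞ lam (jetSet V 1)) (hμ : ContDiffOn ℝ ∞ μ₀ (Prod.fst '' V))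
    (i : Fin (n + 1)) {z : Jet (n + 1) m 2} (hz : z ∈ jetSet V 2) :
    totalDeriv i (alphaComp lam μ₀ i) z =
      (∫ t in (0 : ℝ)..1, ∑ σ,
        (z.2 σ ⟨{i}, by simp⟩ * pderiv1 σ i (lagrangeFun lam) (jetProj (by norm_num) (fibreScale t z))
          + z.2 σ ⟨0, Nat.zero_le _⟩ *
            totalDeriv i (pderiv1 σ i (lagrangeFun lam)) (fibreScale t z)))
        + fderiv ℝ (fun x => baseComp i (μ₀ x)) z.1 (Pi.single i 1) := by
  have hp := fun σ => contDiffOn_pderiv1_lagrangeFun hV hsmooth σ i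
  have hz1 : jetProj (by norm_num : 1 ≤ 2) z ∈ jetSet V 1 := hz
  have hy : ∀ σ, HasFDerivAt (fun z : Jet (n + 1) m 1 => z.2 σ ⟨0, Nat.zero_le _⟩)
      (dyForm σ ⟨0, Nat.zero_le _⟩) (jetProj (by norm_num : 1 ≤ 2) z) :=
    fun σ => (dyForm σ ⟨0, Nat.zero_le _⟩).hasFDerivAt
  have hq := fun σ => (differentiableAt_of_contDiffOn hV
    (contDiffOn_scaleMean hV hstar (hp σ)) hz1).hasFDerivAt
  have hb : HasFDerivAt (fun x => baseComp i (μ₀ x)) _ (jetProj (by norm_num : 1 ≤ 2) z).1 :=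
    ((((contDiff_baseComp i).comp_contDiffOn hμ).contDiffAt ((isOpen_image_fst hV).mem_nhds
      (fst_mem_image hz1))).differentiableAt (by simp)).hasFDerivAt
  have hd := (HasFDerivAt.fun_sum (u := Finset.univ) fun σ _ => (hy σ).mul (hq σ)).add
    (hb.comp _ hasFDerivAt_fst)
  have hI1 : ∀ σ, IntervalIntegrable (fun t => pderiv1 σ i (lagrangeFun lam)
      (jetProj (by norm_num) (fibreScale t z))) volume 0 1 := fun σ =>
    intervalIntegrable_fibreScale hstar (contDiffOn_comp_jetProj (by norm_num) (hp σ)).continuousOn hz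
  have hI2 : ∀ σ, IntervalIntegrable (fun t => totalDeriv i (pderiv1 σ i (lagrangeFun lam))
      (fibreScale t z)) volume 0 1 := fun σ =>
    intervalIntegrable_fibreScale hstar (contDiffOn_totalDeriv hV (hp σ) i).continuousOn hz
  have hval : totalDeriv i (alphaComp lam μ₀ i) z = _ :=
    congrArg (fun L => L (totalVec i z)) hd.fderiv
  rw [hval, intervalIntegral.integral_finsetSum fun σ _ =>
    ((hI1 σ).const_mul _).add ((hI2 σ).const_mul _)]
  simp only [add_apply, sum_apply, smul_apply, ContinuousLinearMap.comp_apply, smul_eq_mul]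
  congr 1
  refine Finset.sum_congr rfl fun σ _ => ?_
  rw [intervalIntegral.integral_add ((hI1 σ).const_mul _) ((hI2 σ).const_mul _),
    intervalIntegral.integral_const_mul, intervalIntegral.integral_const_mul,
    fderiv_scaleMean hV hstar (hp σ) hz1]
  rw [add_comm, mul_comm (scaleMean _ _)]
  rfl

theorem pull_eq_vainbergTonti_add (hV : IsOpen V) (hstar : VerticallyStarShaped V)
    (hsmooth : ContDiffOn ℝ ∞ lam (jetSet V 1)) (hhor : IsHorizontal V lam)
    (hμ : IsBasePrimitive V lam μ₀) {z : Jet (n + 1) m 2} (hz : z ∈ jetSet V 2) :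
    pull (jetProj (by norm_num : 1 ≤ 2)) lam z =
      vainbergTonti lam z + (∑ i, totalDeriv i (alphaComp lam μ₀ i) z) • omega0 := by
  have hz1 : jetProj (by norm_num : 1 ≤ 2) z ∈ jetSet V 1 := hz
  have hL := contDiffOn_lagrangeFun hsmooth
  have hp := contDiffOn_pderiv1_lagrangeFun hV hsmooth
  have h1 : pull (jetProj (by norm_num : 1 ≤ 2)) lam z =
      lagrangeFun lam (jetProj (by norm_num) z) • omega0 := by
    rw [pull, horizontal_eq hhor hz1]
    rfl
  have hI1 : ∀ σ i, IntervalIntegrable (fun t => pderiv1 σ i (lagrangeFun lam)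
      (jetProj (by norm_num) (fibreScale t z))) volume 0 1 := fun σ i =>
    intervalIntegrable_fibreScale hstar
      (contDiffOn_comp_jetProj (by norm_num) (hp σ i)).continuousOn hz
  have hI2 : ∀ σ i, IntervalIntegrable (fun t => totalDeriv i (pderiv1 σ i (lagrangeFun lam))
      (fibreScale t z)) volume 0 1 := fun σ i =>
    intervalIntegrable_fibreScale hstar (contDiffOn_totalDeriv hV (hp σ i) i).continuousOn hz
  have hI3 : ∀ σ, IntervalIntegrable (fun t => eulerLagrange lam σ (fibreScale t z)) volume 0 1 :=
    fun σ => intervalIntegrable_fibreScale hstar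
      (contDiffOn_eulerLagrange hV hsmooth σ).continuousOn hz
  have hL1 := integral_fderiv_fibreScale hV hstar hL hz1
  rw [h1, vainbergTonti_eq hV hstar hsmooth hz, ← add_smul]
  congr 1
  rw [Finset.sum_congr rfl fun i _ => totalDeriv_alphaComp hV hstar hsmooth hμ.1 i hz,
    Finset.sum_add_distrib, sum_fderiv_baseComp hV hμ (fst_mem_image hz),
    ← intervalIntegral.integral_finsetSum, ← add_assoc, ← intervalIntegral.integral_add]
  · rw [← sub_eq_iff_eq_add]
    -- Pointwise in `t`: adding the integrand `y^σ E_σ` cancels the terms with `d_i(∂L/∂y^σ_i)` and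
    -- leaves the derivative of `L` along the scaling, whose integral is `L - L(x, 0)`.
    refine Eq.trans hL1.symm (intervalIntegral.integral_congr fun t _ => ?_)
    rw [vertical_eq_sum, map_sum, Finset.sum_comm, ← Finset.sum_add_distrib]
    refine Finset.sum_congr rfl fun σ _ => ?_
    rw [map_sum, sum_multiIdx_one, eulerLagrange, mul_sub, Finset.sum_add_distrib,
      ← Finset.mul_sum]
    simp only [map_smul, smul_eq_mul]
    rw [← jetProj_fibreScale]
    have hz2 : ∀ σ J, (jetProj (by norm_num : 1 ≤ 2) z).2 σ J =
      z.2 σ ⟨J.1, J.2.trans (by norm_num)⟩ := fun _ _ => rfl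
    simp only [pderiv0, pderiv1, hz2]
    ring
  · exact intervalIntegrable_sum _ fun σ _ => (hI3 σ).const_mul _
  · exact intervalIntegrable_sum _ fun i _ => intervalIntegrable_sum _ fun σ _ =>
      ((hI1 σ i).const_mul _).add ((hI2 σ i).const_mul _)
  · exact fun i _ => intervalIntegrable_sum _ fun σ _ =>
      ((hI1 σ i).const_mul _).add ((hI2 σ i).const_mul _)

end Homotopy

/-! ### Forms spanned by `ω_0`, `ω^σ ∧ ω_i`, `ω^σ_j ∧ ω_i` -/

section Combo

variable {n m r s : ℕ} {V : Set ((Fin (n + 1) → ℝ) × (Fin m → ℝ))}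

/-- The form `l ω_0 + b_σ^i ω^σ ∧ ω_i + c_σ^{ij} ω^σ_j ∧ ω_i`. -/
def contactCombo (l : ℝ) (b : Fin m → Fin (n + 1) → ℝ) (c : Fin m → Fin (n + 1) → Fin (n + 1) → ℝ)
    (z : Jet (n + 1) m (r + 2)) : Jet (n + 1) m (r + 2) [⋀^Fin (n + 1)]→L[ℝ] ℝ :=
  l • omega0 + ∑ σ, ∑ i, b σ i • wedge (contact0 σ z) (omega1 i)
    + ∑ σ, ∑ i, ∑ j, c σ i j • wedge (contact1 σ j z) (omega1 i)

theorem contactCombo_add (l l' : ℝ) (b b' : Fin m → Fin (n + 1) → ℝ)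
    (c c' : Fin m → Fin (n + 1) → Fin (n + 1) → ℝ) (z : Jet (n + 1) m (r + 2)) :
    contactCombo l b c z + contactCombo l' b' c' z =
      contactCombo (l + l') (fun σ i => b σ i + b' σ i) (fun σ i j => c σ i j + c' σ i j) z := by
  simp only [contactCombo, add_smul, Finset.sum_add_distrib]
  abel

theorem contact0_comp_jetProj (h : s + 1 ≤ r + 1) (σ : Fin m) (z : Jet (n + 1) m (r + 1)) :
    (contact0 σ (jetProj h z)).comp (jetProj h) = contact0 σ z := by
  refine ContinuousLinearMap.ext fun v => ?_
  simp [contact0, contactForm, dyForm, dxForm, baseProj, jetProj]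

theorem contact1_comp_jetProj (h : s + 2 ≤ r + 2) (σ : Fin m) (j : Fin (n + 1))
    (z : Jet (n + 1) m (r + 2)) :
    (contact1 σ j (jetProj h z)).comp (jetProj h) = contact1 σ j z := by
  refine ContinuousLinearMap.ext fun v => ?_
  simp [contact1, contactForm, dyForm, dxForm, baseProj, jetProj]

theorem baseProj_comp_jetProj (h : s ≤ r) :
    (baseProj (n := n) (m := m) (r := s)).comp (jetProj h) = baseProj := rfl

/-- The pullback of alternating forms at a point, as a linear map. -/
def compLM {E F : Type} [NormedAddCommGroup E] [NormedSpace ℝ E] [NormedAddCommGroup F]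
    [NormedSpace ℝ F] {k : ℕ} (g : E →L[ℝ] F) : F [⋀^Fin k]→L[ℝ] ℝ →ₗ[ℝ] E [⋀^Fin k]→L[ℝ] ℝ where
  toFun A := A.compContinuousLinearMap g
  map_add' _ _ := rfl
  map_smul' _ _ := rfl

theorem compLM_apply {E F : Type} [NormedAddCommGroup E] [NormedSpace ℝ E] [NormedAddCommGroup F]
    [NormedSpace ℝ F] {k : ℕ} (g : E →L[ℝ] F) (A : F [⋀^Fin k]→L[ℝ] ℝ) :
    compLM g A = A.compContinuousLinearMap g := rfl

/-- Pullback keeps the coefficients. Identities on `V³` between such forms thus reduce to identities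
between coefficients, some of which already live on `V²`. -/
theorem contactCombo_comp_jetProj (h : s + 2 ≤ r + 2) (l : ℝ) (b : Fin m → Fin (n + 1) → ℝ)
    (c : Fin m → Fin (n + 1) → Fin (n + 1) → ℝ) (z : Jet (n + 1) m (r + 2)) :
    (contactCombo l b c (jetProj h z)).compContinuousLinearMap (jetProj h) =
      contactCombo l b c z := by
  have e0 : compLM (jetProj h) (omega0 : Jet (n + 1) m (s + 2) [⋀^Fin (n + 1)]→L[ℝ] ℝ) = omega0 :=
    omega0_comp (baseProj_comp_jetProj h)
  have e1 : ∀ σ i, compLM (jetProj h) (wedge (contact0 σ (jetProj h z)) (omega1 i)) =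
      wedge (contact0 σ z) (omega1 i) := fun σ i => by
    rw [compLM_apply, wedge_comp, contact0_comp_jetProj (by lia), omega1_comp (baseProj_comp_jetProj h)]
  have e2 : ∀ σ i j, compLM (jetProj h) (wedge (contact1 σ j (jetProj h z)) (omega1 i)) =
      wedge (contact1 σ j z) (omega1 i) := fun σ i j => by
    rw [compLM_apply, wedge_comp, contact1_comp_jetProj, omega1_comp (baseProj_comp_jetProj h)]
  rw [← compLM_apply]
  simp only [contactCombo, map_add, map_sum, map_smul, e0, e1, e2]

theorem contDiff_wedge_contact0 (σ : Fin m) (i : Fin (n + 1)) :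
    ContDiff ℝ ∞ fun z : Jet (n + 1) m (r + 1) => wedge (contact0 σ z) (omega1 i) := by
  simp only [wedge_eq, contact0, contactForm]
  fun_prop

theorem contDiff_wedge_contact1 (σ : Fin m) (i j : Fin (n + 1)) :
    ContDiff ℝ ∞ fun z : Jet (n + 1) m (r + 2) => wedge (contact1 σ j z) (omega1 i) := by
  simp only [wedge_eq, contact1, contactForm]
  fun_prop

theorem contDiffOn_contactCombo {S : Set (Jet (n + 1) m (r + 2))} {l : Jet (n + 1) m (r + 2) → ℝ}
    {b : Fin m → Fin (n + 1) → Jet (n + 1) m (r + 2) → ℝ}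
    {c : Fin m → Fin (n + 1) → Fin (n + 1) → Jet (n + 1) m (r + 2) → ℝ}
    (hl : ContDiffOn ℝ ∞ l S) (hb : ∀ σ i, ContDiffOn ℝ ∞ (b σ i) S)
    (hc : ∀ σ i j, ContDiffOn ℝ ∞ (c σ i j) S) :
    ContDiffOn ℝ ∞ (fun z => contactCombo (l z) (fun σ i => b σ i z) (fun σ i j => c σ i j z) z) S :=
  ((hl.smul contDiffOn_const).add (ContDiffOn.sum fun σ _ => ContDiffOn.sum fun i _ =>
    (hb σ i).smul (contDiff_wedge_contact0 σ i).contDiffOn)).add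
    (ContDiffOn.sum fun σ _ => ContDiffOn.sum fun i _ => ContDiffOn.sum fun j _ =>
      (hc σ i j).smul (contDiff_wedge_contact1 σ i j).contDiffOn)

theorem pull_Theta1 (lam : Form (Jet (n + 1) m 1) (n + 1)) (h : 1 ≤ r + 2)
    (z : Jet (n + 1) m (r + 2)) :
    pull (jetProj h) (Theta1 lam) z = contactCombo (lagrangeFun lam (jetProj h z))
      (fun σ i => pderiv1 σ i (lagrangeFun lam) (jetProj h z)) (fun _ _ _ => 0) z := by
  have e0 : compLM (jetProj h) (omega0 : Jet (n + 1) m 1 [⋀^Fin (n + 1)]→L[ℝ] ℝ) = omega0 :=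
    omega0_comp (baseProj_comp_jetProj h)
  have e1 : ∀ σ i, compLM (jetProj h) (wedge (contact0 σ (jetProj h z)) (omega1 i)) =
      wedge (contact0 σ z) (omega1 i) := fun σ i => by
    rw [compLM_apply, wedge_comp, contact0_comp_jetProj (s := 0) (by lia),
      omega1_comp (baseProj_comp_jetProj h)]
  rw [pull, ← compLM_apply]
  simp only [Theta1, contactCombo, map_add, map_sum, map_smul, e0, e1, zero_smul,
    Finset.sum_const_zero, add_zero]

/-- The exterior derivative of `α^i ω_i`, on the 2-jet space. -/
theorem pull_extDeriv_sum_omega1 {a : Fin (n + 1) → Jet (n + 1) m 1 → ℝ}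
    {z : Jet (n + 1) m 2} (ha : ∀ i, DifferentiableAt ℝ (a i) (jetProj (by norm_num) z)) :
    (extDeriv (fun z => ∑ i, a i z • omega1 i)
      (jetProj (by norm_num : 1 ≤ 2) z)).compContinuousLinearMap (jetProj (by norm_num)) =
    contactCombo (r := 0) (∑ i, totalDeriv i (a i) z)
      (fun σ i => pderiv0 σ (a i) (jetProj (by norm_num) z))
      (fun σ i j => pderiv1 σ j (a i) (jetProj (by norm_num) z)) z := by
  rw [extDeriv_sum _ fun i _ => (ha i).smul_const _, ← compLM_apply, map_sum]
  have h1 : ∀ i, compLM (jetProj (by norm_num : 1 ≤ 2))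
      (extDeriv (fun z => a i z • omega1 i) (jetProj (by norm_num : 1 ≤ 2) z)) =
      totalDeriv i (a i) z • omega0 + ∑ σ,
        (pderiv0 σ (a i) (jetProj (by norm_num) z) • wedge (contact0 σ z) (omega1 i) +
          ∑ j, pderiv1 σ j (a i) (jetProj (by norm_num) z) • wedge (contact1 σ j z) (omega1 i)) := by
    intro i
    -- The differential splits into `d_k a^i dx^k` and a contact part; in the wedge with `ω_i` only
    -- `k = i` survives from the first.
    have hsplit : (fderiv ℝ (a i) (jetProj (by norm_num) z)).comp (jetProj (by norm_num : 1 ≤ 2)) =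
        (fderiv ℝ (a i) (jetProj (by norm_num) z)).comp (horPart z) +
        (fderiv ℝ (a i) (jetProj (by norm_num) z)).comp (contactPart z) := by
      rw [← ContinuousLinearMap.comp_add, contactPart, add_sub_cancel]
    rw [extDeriv_smul_const (ha i), compLM_apply, wedge_comp, hsplit, comp_horPart,
      comp_contactPart_one, omega1_comp (baseProj_comp_jetProj _)]
    simp only [wedge_add_left, wedge_sum_left, wedge_smul_left, wedge_dxForm_omega1]
    congr 1
    simp [totalDeriv]
  rw [Finset.sum_congr rfl fun i _ => h1 i]
  simp only [Finset.sum_add_distrib, contactCombo, Finset.sum_smul]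
  rw [add_assoc]
  congr 2
  · exact Finset.sum_comm
  · exact Finset.sum_comm

end Combo

/-! ### The form `p_1 d ν` -/

section Nu

variable {n m : ℕ} {V : Set ((Fin (n + 1) → ℝ) × (Fin m → ℝ))}

/-- The second term is `d(ω^σ ∧ ω_{ij}) = -dy^σ_l ∧ dx^l ∧ ω_{ij}`, evaluated with
`wedgeInterior_dxForm_omega1`. -/
theorem extDeriv_smul_wedgeInterior {f : Jet (n + 1) m 1 → ℝ} {w : Jet (n + 1) m 1}
    (hf : DifferentiableAt ℝ f w) (σ : Fin m) (i j : Fin (n + 1)) :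
    extDeriv (fun z => f z • wedgeInterior (contact0 σ z) (dX j) (omega1 i)) w =
      wedge (fderiv ℝ f w) (wedgeInterior (contact0 σ w) (dX j) (omega1 i))
        - f w • (wedge (dyForm σ ⟨{j}, by simp⟩) (omega1 i)
          - wedge (dyForm σ ⟨{i}, by simp⟩) (omega1 j)) := by
  have hy : ∀ l, HasFDerivAt (fun z : Jet (n + 1) m 1 => z.2 σ ⟨{l}, by simp⟩)
      (dyForm σ ⟨{l}, by simp⟩) w := fun l => (dyForm σ ⟨{l}, by simp⟩).hasFDerivAt
  have h1 : (fun z : Jet (n + 1) m 1 => wedgeInterior (contact0 σ z) (dX j) (omega1 i)) =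
      fun z => wedgeInterior (dyForm σ ⟨0, by simp⟩) (dX j) (omega1 i) -
        ∑ l, z.2 σ ⟨{l}, by simp⟩ • wedgeInterior (dxForm l) (dX j) (omega1 i) := by
    funext z
    simp only [wedgeInterior_eq, contact0, contactForm, map_sub, map_sum, map_smul]
    rfl
  have h2 : HasFDerivAt (fun z : Jet (n + 1) m 1 => wedgeInterior (contact0 σ z) (dX j) (omega1 i))
      (-∑ l, (dyForm σ ⟨{l}, by simp⟩).smulRight
        (wedgeInterior (dxForm l) (dX j) (omega1 i))) w := by
    rw [h1]
    exact (HasFDerivAt.fun_sum fun l _ => (hy l).smul_const _).const_sub _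
  rw [extDeriv, (hf.hasFDerivAt.fun_smul h2).fderiv]
  rw [← ContinuousAlternatingMap.alternatizeUncurryFinCLM_apply, map_add, map_smul, map_neg,
    map_sum]
  have h3 : ∀ l, ContinuousAlternatingMap.alternatizeUncurryFinCLM ℝ (Jet (n + 1) m 1) ℝ
      ((dyForm σ ⟨{l}, by simp⟩).smulRight (wedgeInterior (dxForm l) (dX j) (omega1 i))) =
      (if l = j then (1 : ℝ) else 0) • wedge (dyForm σ ⟨{l}, by simp⟩) (omega1 i) -
        (if l = i then (1 : ℝ) else 0) • wedge (dyForm σ ⟨{l}, by simp⟩) (omega1 j) := by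
    intro l
    rw [wedgeInterior_dxForm_omega1]
    exact (wedge_sub_right _ _ _).trans (by rw [wedge_smul_right, wedge_smul_right])
  rw [Finset.sum_congr rfl fun l _ => h3 l, Finset.sum_sub_distrib, smul_neg, neg_add_eq_sub]
  congr 1
  simp

/-- The derivative of the pullback of alternating forms at a point, as a linear map. -/
def fderivCompLM {E F : Type} [NormedAddCommGroup E] [NormedSpace ℝ E] [NormedAddCommGroup F]
    [NormedSpace ℝ F] {k : ℕ} (H P : E →L[ℝ] F) :
    F [⋀^Fin k]→L[ℝ] ℝ →ₗ[ℝ] E [⋀^Fin k]→L[ℝ] ℝ where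
  toFun A := A.fderivCompContinuousLinearMap H P
  map_add' A B := by
    ext v
    simp [ContinuousAlternatingMap.fderivCompContinuousLinearMap_apply, Finset.sum_add_distrib]
  map_smul' c A := by
    ext v
    simp [ContinuousAlternatingMap.fderivCompContinuousLinearMap_apply, Finset.mul_sum]

theorem fderivCompLM_apply {E F : Type} [NormedAddCommGroup E] [NormedSpace ℝ E]
    [NormedAddCommGroup F] [NormedSpace ℝ F] {k : ℕ} (H P : E →L[ℝ] F) (A : F [⋀^Fin k]→L[ℝ] ℝ) :
    fderivCompLM H P A = A.fderivCompContinuousLinearMap H P := rfl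

theorem fderivComp_comp_baseProj {k r : ℕ} (β : (Fin n → ℝ) [⋀^Fin k]→L[ℝ] ℝ)
    (z : Jet n m (r + 1)) :
    (β.compContinuousLinearMap baseProj).fderivCompContinuousLinearMap (horPart z)
      (contactPart z) = 0 := by
  ext v
  rw [ContinuousAlternatingMap.fderivCompContinuousLinearMap_apply]
  refine Finset.sum_eq_zero fun i _ => ?_
  rw [ContinuousAlternatingMap.compContinuousLinearMap_apply]
  refine ContinuousAlternatingMap.map_coord_zero _ i ?_
  simp only [Function.comp_apply, Function.update_self]
  exact congrArg (fun L => L (v i)) (baseProj_comp_contactPart z)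

theorem wedgeInterior_contact0_comp_horPart (σ : Fin m) (i j : Fin (n + 1))
    (z : Jet (n + 1) m 2) :
    (wedgeInterior (contact0 σ (jetProj (by norm_num : 1 ≤ 2) z)) (dX j)
      (omega1 i)).compContinuousLinearMap (horPart z) = 0 := by
  cases n with
  | zero => rfl
  | succ n =>
    simp only [wedgeInterior]
    rw [wedge_comp, contact0_comp_horPart (r := 0), wedge_zero_left]

/-- `ω^σ ∧ ω_{ij}` is purely 1-contact: `ω^σ` vanishes on horizontal vectors, so the one contact
argument must go into it. -/
theorem fderivComp_wedgeInterior_contact0 (σ : Fin m) (i j : Fin (n + 1))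
    (z : Jet (n + 1) m 2) :
    (wedgeInterior (contact0 σ (jetProj (by norm_num : 1 ≤ 2) z)) (dX j)
      (omega1 i)).fderivCompContinuousLinearMap (horPart z) (contactPart z) =
      wedgeInterior (contact0 σ z) (dX j) (omega1 i) := by
  cases n with
  | zero =>
    simp only [wedgeInterior]
    exact map_zero (fderivCompLM (horPart z) (contactPart z))
  | succ n =>
    simp only [wedgeInterior]
    rw [wedge_fderivComp, contact0_comp_horPart (r := 0), wedge_zero_left, add_zero,
      contact0_comp_contactPart (r := 0), omega1_eq, omega1_eq, curryLeft_comp_baseProj,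
      curryLeft_comp_baseProj, comp_baseProj_comp, baseProj_comp_horPart]
    rfl

theorem fderivComp_wedge_dyForm (σ : Fin m) (i j : Fin (n + 1)) (z : Jet (n + 1) m 2) :
    (wedge (dyForm σ ⟨{j}, by simp⟩) (omega1 i : Jet (n + 1) m 1 [⋀^Fin n]→L[ℝ] ℝ)
      ).fderivCompContinuousLinearMap (horPart z) (contactPart z) =
      wedge (contact1 σ j z) (omega1 i) := by
  rw [wedge_fderivComp, dyForm_comp_contactPart, omega1_comp (baseProj_comp_horPart z)]
  rw [omega1_eq (r := 1), fderivComp_comp_baseProj, wedge_zero_right, add_zero]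
  rfl

/-- The 1-contact component of `d(f ω^σ ∧ ω_{ij})`. -/
theorem fderivComp_extDeriv_smul_wedgeInterior {f : Jet (n + 1) m 1 → ℝ} {z : Jet (n + 1) m 2}
    (hf : DifferentiableAt ℝ f (jetProj (by norm_num : 1 ≤ 2) z)) (σ : Fin m) (i j : Fin (n + 1)) :
    (extDeriv (fun z => f z • wedgeInterior (contact0 σ z) (dX j) (omega1 i))
      (jetProj (by norm_num : 1 ≤ 2) z)).fderivCompContinuousLinearMap (horPart z) (contactPart z) =
    (totalDeriv i f z • wedge (contact0 σ z) (omega1 j)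
      - totalDeriv j f z • wedge (contact0 σ z) (omega1 i))
      - f (jetProj (by norm_num) z) • (wedge (contact1 σ j z) (omega1 i)
          - wedge (contact1 σ i z) (omega1 j)) := by
  rw [extDeriv_smul_wedgeInterior hf, ← fderivCompLM_apply]
  simp only [map_sub, map_smul]
  simp only [fderivCompLM_apply, fderivComp_wedge_dyForm]
  rw [wedge_fderivComp, wedgeInterior_contact0_comp_horPart, wedge_zero_right, zero_add,
    fderivComp_wedgeInterior_contact0, comp_horPart, wedge_sum_left]
  congr 1
  -- Moving `dx^k` past `ω^σ` changes the sign, and `dx^k ∧ ω_{ij}` selects `k = i` or `k = j`.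
  have h1 : ∀ k, wedge (fderiv ℝ f (jetProj (by norm_num) z) (totalVec k z) • dxForm k)
      (wedgeInterior (contact0 σ z) (dX j) (omega1 i)) =
      (if k = i then (1 : ℝ) else 0) • totalDeriv k f z • wedge (contact0 σ z) (omega1 j)
      - (if k = j then (1 : ℝ) else 0) • totalDeriv k f z • wedge (contact0 σ z) (omega1 i) := by
    intro k
    rw [wedge_smul_left, wedge_wedgeInterior_comm, wedgeInterior_dxForm_omega1, wedge_sub_right,
      wedge_smul_right, wedge_smul_right, neg_sub, smul_sub, totalDeriv, smul_comm,
      smul_comm (fderiv ℝ f _ _)]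
  rw [Finset.sum_congr rfl fun k _ => h1 k, Finset.sum_sub_distrib]
  simp

/-- The coefficients of the form `ν`. -/
def nuCoeff (a : Fin (n + 1) → Jet (n + 1) m 1 → ℝ) (σ : Fin m) (i j : Fin (n + 1))
    (z : Jet (n + 1) m 1) : ℝ :=
  (1 / 4 : ℝ) * (pderiv1 σ i (a j) z - pderiv1 σ j (a i) z)

theorem contDiffOn_nuCoeff (hV : IsOpen V) {a : Fin (n + 1) → Jet (n + 1) m 1 → ℝ}
    (ha : ∀ i, ContDiffOn ℝ ∞ (a i) (jetSet V 1)) (σ : Fin m) (i j : Fin (n + 1)) :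
    ContDiffOn ℝ ∞ (nuCoeff a σ i j) (jetSet V 1) :=
  contDiffOn_const.mul
    ((contDiffOn_fderiv_apply hV (ha j) _).sub (contDiffOn_fderiv_apply hV (ha i) _))

theorem nuCoeff_swap (a : Fin (n + 1) → Jet (n + 1) m 1 → ℝ) (σ : Fin m) (i j : Fin (n + 1))
    (z : Jet (n + 1) m 1) : nuCoeff a σ j i z = -nuCoeff a σ i j z := by
  simp only [nuCoeff]
  ring

theorem totalDeriv_nuCoeff_swap (a : Fin (n + 1) → Jet (n + 1) m 1 → ℝ) (σ : Fin m)
    (i j k : Fin (n + 1)) (z : Jet (n + 1) m 2) :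
    totalDeriv k (nuCoeff a σ j i) z = -totalDeriv k (nuCoeff a σ i j) z := by
  rw [show nuCoeff a σ j i = fun z => -nuCoeff a σ i j z from funext (nuCoeff_swap a σ i j)]
  simp only [totalDeriv, fderiv_fun_neg]
  rfl

theorem contDiff_wedgeInterior_contact0 (σ : Fin m) (i j : Fin (n + 1)) :
    ContDiff ℝ ∞ fun z : Jet (n + 1) m 1 => wedgeInterior (contact0 σ z) (dX j) (omega1 i) := by
  simp only [wedgeInterior_eq, contact0, contactForm]
  fun_prop

/-- The coefficients of `ν` are antisymmetric in `i, j`, so the two halves of each antisymmetrized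
term agree after relabelling; this is the source of the factor `-2`. -/
theorem p1_extDeriv_nuForm (hV : IsOpen V) {a : Fin (n + 1) → Jet (n + 1) m 1 → ℝ}
    (ha : ∀ i, ContDiffOn ℝ ∞ (a i) (jetSet V 1)) {z : Jet (n + 1) m 2} (hz : z ∈ jetSet V 2) :
    p1 (extDeriv (nuForm a)) z = contactCombo (r := 0) 0
      (fun σ i => -2 * ∑ j, totalDeriv j (nuCoeff a σ i j) z)
      (fun σ i j => -2 * nuCoeff a σ i j (jetProj (by norm_num) z)) z := by
  have hz1 : jetProj (by norm_num : 1 ≤ 2) z ∈ jetSet V 1 := hz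
  have hB : ∀ σ i j, DifferentiableAt ℝ (nuCoeff a σ i j) (jetProj (by norm_num : 1 ≤ 2) z) :=
    fun σ i j => differentiableAt_of_contDiffOn hV (contDiffOn_nuCoeff hV ha σ i j) hz1
  have hd : ∀ σ i j, DifferentiableAt ℝ (fun z => nuCoeff a σ i j z •
      wedgeInterior (contact0 σ z) (dX j) (omega1 i)) (jetProj (by norm_num : 1 ≤ 2) z) :=
    fun σ i j => (hB σ i j).smul
      ((contDiff_wedgeInterior_contact0 σ i j).differentiable (by simp) _)
  have h1 : extDeriv (nuForm a) (jetProj (by norm_num : 1 ≤ 2) z) = ∑ σ, ∑ i, ∑ j,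
      extDeriv (fun z => nuCoeff a σ i j z • wedgeInterior (contact0 σ z) (dX j) (omega1 i))
        (jetProj (by norm_num : 1 ≤ 2) z) := by
    have h2 : nuForm a = fun z => ∑ σ, ∑ i, ∑ j,
      nuCoeff a σ i j z • wedgeInterior (contact0 σ z) (dX j) (omega1 i) := rfl
    rw [h2, extDeriv_sum _ fun σ _ => DifferentiableAt.fun_sum fun i _ =>
      DifferentiableAt.fun_sum fun j _ => hd σ i j]
    refine Finset.sum_congr rfl fun σ _ => ?_
    rw [extDeriv_sum _ fun i _ => DifferentiableAt.fun_sum fun j _ => hd σ i j]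
    exact Finset.sum_congr rfl fun i _ => extDeriv_sum _ fun j _ => hd σ i j
  have h3 : p1 (extDeriv (nuForm a)) z = ∑ σ, ∑ i, ∑ j,
      (extDeriv (fun z => nuCoeff a σ i j z • wedgeInterior (contact0 σ z) (dX j) (omega1 i))
        (jetProj (by norm_num : 1 ≤ 2) z)).fderivCompContinuousLinearMap (horPart z)
          (contactPart z) := by
    rw [p1, h1, ← fderivCompLM_apply]
    simp only [map_sum, fderivCompLM_apply]
  have hswap : ∀ P Q : Fin (n + 1) → Fin (n + 1) → Jet (n + 1) m 2 [⋀^Fin (n + 1)]→L[ℝ] ℝ,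
      ∑ i, ∑ j, ((-P j i - P i j) - (Q i j + Q j i)) =
        (-2 : ℝ) • (∑ i, ∑ j, P i j) + (-2 : ℝ) • (∑ i, ∑ j, Q i j) := by
    intro P Q
    simp only [Finset.sum_sub_distrib, Finset.sum_add_distrib, Finset.sum_neg_distrib]
    rw [Finset.sum_comm (f := fun i j => P j i), Finset.sum_comm (f := fun i j => Q j i)]
    module
  -- Antisymmetry is used to swap the indices in half of the terms, so that each becomes a
  -- relabelling of its partner and `hswap` applies.
  have hterm : ∀ σ i j, (extDeriv (fun z => nuCoeff a σ i j z •
      wedgeInterior (contact0 σ z) (dX j) (omega1 i))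
        (jetProj (by norm_num : 1 ≤ 2) z)).fderivCompContinuousLinearMap (horPart z)
          (contactPart z) =
      (-(totalDeriv i (nuCoeff a σ j i) z • wedge (contact0 σ z) (omega1 j))
        - totalDeriv j (nuCoeff a σ i j) z • wedge (contact0 σ z) (omega1 i))
      - (nuCoeff a σ i j (jetProj (by norm_num) z) • wedge (contact1 σ j z) (omega1 i)
        + nuCoeff a σ j i (jetProj (by norm_num) z) • wedge (contact1 σ i z) (omega1 j)) := by
    intro σ i j
    rw [fderivComp_extDeriv_smul_wedgeInterior (hB σ i j), totalDeriv_nuCoeff_swap a σ i j,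
      nuCoeff_swap a σ i j]
    module
  have hsum : ∀ σ, ∑ i, ∑ j, (extDeriv (fun z => nuCoeff a σ i j z •
      wedgeInterior (contact0 σ z) (dX j) (omega1 i))
        (jetProj (by norm_num : 1 ≤ 2) z)).fderivCompContinuousLinearMap (horPart z)
          (contactPart z) =
      ∑ i, (-2 * ∑ j, totalDeriv j (nuCoeff a σ i j) z) • wedge (contact0 σ z) (omega1 i)
      + ∑ i, ∑ j, (-2 * nuCoeff a σ i j (jetProj (by norm_num) z)) •
          wedge (contact1 σ j z) (omega1 i) := by
    intro σ
    refine (Finset.sum_congr rfl fun i _ => Finset.sum_congr rfl fun j _ => hterm σ i j).trans ?_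
    refine (hswap (fun i j => totalDeriv j (nuCoeff a σ i j) z • wedge (contact0 σ z) (omega1 i))
      fun i j => nuCoeff a σ i j (jetProj (by norm_num) z) •
        wedge (contact1 σ j z) (omega1 i)).trans ?_
    simp only [Finset.smul_sum, smul_smul, Finset.mul_sum, Finset.sum_smul]
  rw [h3, Finset.sum_congr rfl fun σ _ => hsum σ, Finset.sum_add_distrib]
  simp only [contactCombo, zero_smul, zero_add]

end Nu

/-! ### Derivatives of total derivatives -/

section TotalDerivative

variable {n m r : ℕ} {V : Set ((Fin n → ℝ) × (Fin m → ℝ))}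

/-- The source of all commutators: `d_k f` is `df` paired with `totalVec k`. Differentiating `df`
gives the first term by symmetry of the second derivative; differentiating the affine map `totalVec
k` gives the second. -/
theorem fderiv_totalDeriv (hV : IsOpen V) {f : Jet n m r → ℝ} (hf : ContDiffOn ℝ ∞ f (jetSet V r))
    (k : Fin n) {z : Jet n m (r + 1)} (hz : z ∈ jetSet V (r + 1)) (u : Jet n m (r + 1)) :
    fderiv ℝ (totalDeriv k f) z u =
      totalDeriv k (fun w => fderiv ℝ f w (jetProj r.le_succ u)) z
        + fderiv ℝ f (jetProj r.le_succ z) (totalLin k u) := by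
  have hz1 : jetProj r.le_succ z ∈ jetSet V r := hz
  have hf2 : ContDiffAt ℝ ∞ f (jetProj r.le_succ z) :=
    hf.contDiffAt ((isOpen_jetSet hV r).mem_nhds hz1)
  have hd : DifferentiableAt ℝ (fderiv ℝ f) (jetProj r.le_succ z) :=
    (hf2.fderiv_right (m := 1) (by norm_cast)).differentiableAt one_ne_zero
  have hsymm := hf2.isSymmSndFDerivAt (by simp; norm_cast)
  have h1 : HasFDerivAt (fun z : Jet n m (r + 1) => fderiv ℝ f (jetProj r.le_succ z)) _ z :=
    hd.hasFDerivAt.comp z (jetProj r.le_succ).hasFDerivAt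
  have h2 : HasFDerivAt (totalVec k : Jet n m (r + 1) → Jet n m r) (totalLin k) z := by
    rw [totalVec_eq_fun]
    exact (totalLin k).hasFDerivAt.const_add _
  have h3 : HasFDerivAt (totalDeriv k f) _ z := h1.clm_apply h2
  have h4 : HasFDerivAt (fun w => fderiv ℝ f w (jetProj r.le_succ u)) _ (jetProj r.le_succ z) :=
    hd.hasFDerivAt.clm_apply (hasFDerivAt_const _ _)
  rw [h3.fderiv, totalDeriv, h4.fderiv]
  simp only [add_apply, ContinuousLinearMap.comp_apply, ContinuousLinearMap.flip_apply]
  rw [add_comm, hsymm.eq]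
  simp

theorem totalLin_dY (k : Fin n) (σ : Fin m) (J : MultiIdx n (r + 1)) (K : MultiIdx n r)
    (h : J.1 = k ::ₘ K.1) : totalLin k (dY σ J : Jet n m (r + 1)) = dY σ K := by
  refine Prod.ext rfl ?_
  funext τ L
  by_cases hτ : τ = σ
  · subst hτ
    by_cases hL : L = K
    · subst hL
      have : J = ⟨k ::ₘ L.1, h ▸ J.2⟩ := Subtype.ext h
      simp [totalLin, dY, ← this]
    · have : (⟨k ::ₘ L.1, by simpa using L.2⟩ : MultiIdx n (r + 1)) ≠ J := by
        intro hJ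
        have h1 : k ::ₘ L.1 = J.1 := congrArg Subtype.val hJ
        rw [h, Multiset.cons_inj_right] at h1
        exact hL (Subtype.ext h1)
      simp [totalLin, dY, hL, this]
  · simp [totalLin, dY, hτ]

theorem totalLin_dY_of_notMem (k : Fin n) (σ : Fin m) (J : MultiIdx n (r + 1)) (h : k ∉ J.1) :
    totalLin k (dY σ J : Jet n m (r + 1)) = 0 := by
  refine Prod.ext rfl ?_
  funext τ L
  by_cases hτ : τ = σ
  · subst hτ
    have : (⟨k ::ₘ L.1, by simpa using L.2⟩ : MultiIdx n (r + 1)) ≠ J := by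
      intro hJ
      exact h (congrArg Subtype.val hJ ▸ Multiset.mem_cons_self k L.1)
    simp [totalLin, dY, this]
  · simp [totalLin, dY, hτ]

theorem jetProj_dY (h : r ≤ r + 1) (σ : Fin m) (J : MultiIdx n r) :
    jetProj h (dY σ ⟨J.1, J.2.trans h⟩ : Jet n m (r + 1)) = dY σ J := by
  refine Prod.ext rfl ?_
  funext τ L
  by_cases hτ : τ = σ
  · subst hτ
    simp [jetProj, dY, Pi.single_apply, Subtype.ext_iff]
  · simp [jetProj, dY, hτ]

theorem jetProj_dY_of_card {s : ℕ} (h : s ≤ r) (σ : Fin m) (J : MultiIdx n r) (hJ : s < J.1.card) :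
    jetProj h (dY σ J : Jet n m r) = 0 := by
  refine Prod.ext rfl ?_
  funext τ L
  by_cases hτ : τ = σ
  · subst hτ
    have : (⟨L.1, L.2.trans h⟩ : MultiIdx n r) ≠ J := by
      rintro rfl
      exact absurd L.2 (not_le.2 hJ)
    simp [jetProj, dY, this]
  · simp [jetProj, dY, hτ]

theorem pderiv1_totalDeriv (hV : IsOpen V) {f : Jet n m 1 → ℝ}
    (hf : ContDiffOn ℝ ∞ f (jetSet V 1)) (k i : Fin n) (σ : Fin m) {z : Jet n m 2}
    (hz : z ∈ jetSet V 2) :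
    pderiv1 σ i (totalDeriv k f) z = totalDeriv k (pderiv1 σ i f) z
      + if k = i then pderiv0 σ f (jetProj (by norm_num) z) else 0 := by
  rw [pderiv1, fderiv_totalDeriv hV hf k hz,
    jetProj_dY (r := 1) (by norm_num) σ ⟨{i}, by simp⟩]
  congr 1
  split_ifs with h
  · subst h
    rw [totalLin_dY k σ _ ⟨0, by simp⟩ (by simp)]
    rfl
  · rw [totalLin_dY_of_notMem k σ _ (by simpa using h), map_zero]

/-- Only the motion of `totalVec k` contributes, as `f` does not depend on second order coordinates.
The weight in `pderiv2` makes the formula uniform: for `i = j` the two halves add up to one, for `i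
≠ j` at most one of them is present. -/
theorem pderiv2_totalDeriv (hV : IsOpen V) {f : Jet n m 1 → ℝ}
    (hf : ContDiffOn ℝ ∞ f (jetSet V 1)) (k i j : Fin n) (σ : Fin m) {z : Jet n m 2}
    (hz : z ∈ jetSet V 2) :
    pderiv2 σ i j (totalDeriv k f) z =
      (1 / 2 : ℝ) * ((if k = i then pderiv1 σ j f (jetProj (by norm_num) z) else 0)
        + if k = j then pderiv1 σ i f (jetProj (by norm_num) z) else 0) := by
  have h0 : totalDeriv k (fun w => fderiv ℝ f w 0) z = 0 := by
    simp [totalDeriv]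
  rw [pderiv2, fderiv_totalDeriv hV hf k hz, jetProj_dY_of_card _ σ _ (by simp), h0, zero_add]
  by_cases hi : k = i
  · subst hi
    rw [totalLin_dY k σ _ ⟨{j}, by simp⟩ (by simp)]
    by_cases hj : k = j
    · subst hj
      simp only [if_true]
      rw [pderiv1]
      ring
    · simp only [if_true, hj, if_false, pderiv1, add_zero]
  · by_cases hj : k = j
    · subst hj
      rw [totalLin_dY k σ _ ⟨{i}, by simp⟩ (Multiset.pair_comm i k)]
      simp only [if_true, hi, Ne.symm hi, if_false, pderiv1, zero_add]
    · rw [totalLin_dY_of_notMem k σ _ (by simp [hi, hj])]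
      simp [hi, hj]

theorem fderiv_comp_jetProj {s : ℕ} (h : s ≤ r) {f : Jet n m s → ℝ} {z : Jet n m r}
    (hf : DifferentiableAt ℝ f (jetProj h z)) (u : Jet n m r) :
    fderiv ℝ (fun z => f (jetProj h z)) z u = fderiv ℝ f (jetProj h z) (jetProj h u) := by
  have h1 : HasFDerivAt (fun z => f (jetProj h z)) _ z :=
    hf.hasFDerivAt.comp z (jetProj h).hasFDerivAt
  rw [h1.fderiv]
  rfl

end TotalDerivative

/-! ### The canonical Lepage equivalent -/

section Canonical

variable {n m : ℕ} {V : Set ((Fin (n + 1) → ℝ) × (Fin m → ℝ))}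
  {lam : Form (Jet (n + 1) m 1) (n + 1)} {L : Jet (n + 1) m 1 → ℝ}
  {a : Fin (n + 1) → Jet (n + 1) m 1 → ℝ} {ell : Jet (n + 1) m 2 → ℝ}

theorem pderiv1_sub_divergence (hV : IsOpen V) (hL : ContDiffOn ℝ ∞ L (jetSet V 1))
    (ha : ∀ i, ContDiffOn ℝ ∞ (a i) (jetSet V 1))
    (hell : ∀ z ∈ jetSet V 2, ell z = L (jetProj (by norm_num) z) - ∑ k, totalDeriv k (a k) z)
    (σ : Fin m) (i : Fin (n + 1)) {z : Jet (n + 1) m 2} (hz : z ∈ jetSet V 2) :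
    pderiv1 σ i ell z = pderiv1 σ i L (jetProj (by norm_num) z)
      - (∑ k, totalDeriv k (pderiv1 σ i (a k)) z + pderiv0 σ (a i) (jetProj (by norm_num) z)) := by
  have hz1 : jetProj (by norm_num : 1 ≤ 2) z ∈ jetSet V 1 := hz
  have hev : ell =ᶠ[𝓝 z] fun z => L (jetProj (by norm_num) z) - ∑ k, totalDeriv k (a k) z :=
    eventually_of_mem ((isOpen_jetSet hV 2).mem_nhds hz) hell
  have hdL := differentiableAt_of_contDiffOn hV hL hz1
  have hd1 := differentiableAt_of_contDiffOn hV
    (contDiffOn_comp_jetProj (by norm_num : 1 ≤ 2) hL) hz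
  have hd2 : ∀ k, DifferentiableAt ℝ (totalDeriv k (a k)) z := fun k =>
    differentiableAt_of_contDiffOn hV (contDiffOn_totalDeriv hV (ha k) k) hz
  have h1 : ∀ k, fderiv ℝ (totalDeriv k (a k)) z (dY σ ⟨{i}, by simp⟩) = _ := fun k =>
    pderiv1_totalDeriv hV (ha k) k i σ hz
  rw [pderiv1, hev.fderiv_eq, fderiv_fun_sub hd1 (DifferentiableAt.fun_sum fun k _ => hd2 k),
    sub_apply, fderiv_comp_jetProj _ hdL, jetProj_dY (r := 1) (by norm_num) σ ⟨{i}, by simp⟩,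
    fderiv_fun_sum fun k _ => hd2 k, sum_apply, Finset.sum_congr rfl fun k _ => h1 k,
    Finset.sum_add_distrib]
  simp [pderiv1]

theorem pderiv2_sub_divergence (hV : IsOpen V) (hL : ContDiffOn ℝ ∞ L (jetSet V 1))
    (ha : ∀ i, ContDiffOn ℝ ∞ (a i) (jetSet V 1))
    (hell : ∀ z ∈ jetSet V 2, ell z = L (jetProj (by norm_num) z) - ∑ k, totalDeriv k (a k) z)
    (σ : Fin m) (i j : Fin (n + 1)) {z : Jet (n + 1) m 2} (hz : z ∈ jetSet V 2) :
    pderiv2 σ i j ell z = -(1 / 2 : ℝ) * (pderiv1 σ j (a i) (jetProj (by norm_num) z)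
      + pderiv1 σ i (a j) (jetProj (by norm_num) z)) := by
  have hz1 : jetProj (by norm_num : 1 ≤ 2) z ∈ jetSet V 1 := hz
  have hev : ell =ᶠ[𝓝 z] fun z => L (jetProj (by norm_num) z) - ∑ k, totalDeriv k (a k) z :=
    eventually_of_mem ((isOpen_jetSet hV 2).mem_nhds hz) hell
  have hdL := differentiableAt_of_contDiffOn hV hL hz1
  have hd1 := differentiableAt_of_contDiffOn hV
    (contDiffOn_comp_jetProj (by norm_num : 1 ≤ 2) hL) hz
  have hd2 : ∀ k, DifferentiableAt ℝ (totalDeriv k (a k)) z := fun k =>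
    differentiableAt_of_contDiffOn hV (contDiffOn_totalDeriv hV (ha k) k) hz
  have h1 : ∀ k, (if i = j then 1 else 1 / 2) *
      fderiv ℝ (totalDeriv k (a k)) z (dY σ ⟨{i, j}, by simp⟩) = _ := fun k =>
    pderiv2_totalDeriv hV (ha k) k i j σ hz
  rw [pderiv2, hev.fderiv_eq, fderiv_fun_sub hd1 (DifferentiableAt.fun_sum fun k _ => hd2 k),
    sub_apply, fderiv_comp_jetProj _ hdL, jetProj_dY_of_card _ σ _ (by simp), map_zero, zero_sub,
    fderiv_fun_sum fun k _ => hd2 k, sum_apply, mul_neg, Finset.mul_sum,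
    Finset.sum_congr rfl fun k _ => h1 k, ← Finset.mul_sum, Finset.sum_add_distrib]
  simp

theorem totalDeriv_comp_jetProj {r s : ℕ} (h : s ≤ r) {f : Jet (n + 1) m s → ℝ}
    {z : Jet (n + 1) m (r + 1)} (hf : DifferentiableAt ℝ f (jetProj (h.trans r.le_succ) z))
    (k : Fin (n + 1)) :
    totalDeriv k (fun z => f (jetProj h z)) z =
      totalDeriv k f (jetProj (Nat.succ_le_succ h) z) := by
  rw [totalDeriv, fderiv_comp_jetProj h hf]
  rfl

/-- The symmetric combination is rewritten as `2 N_{ij} - ∂α^j/∂y^σ_i`, so that after summation over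
`j` the last term cancels the total derivatives in `pderiv1_sub_divergence`. No third order
coordinate enters. -/
theorem sum_totalDeriv_pderiv2 (hV : IsOpen V) (hL : ContDiffOn ℝ ∞ L (jetSet V 1))
    (ha : ∀ i, ContDiffOn ℝ ∞ (a i) (jetSet V 1))
    (hell : ∀ z ∈ jetSet V 2, ell z = L (jetProj (by norm_num) z) - ∑ k, totalDeriv k (a k) z)
    (σ : Fin m) (i j : Fin (n + 1)) {z : Jet (n + 1) m 3} (hz : z ∈ jetSet V 3) :
    totalDeriv j (pderiv2 σ i j ell) z =
      2 * totalDeriv j (nuCoeff a σ i j) (jetProj (by norm_num) z)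
        - totalDeriv j (pderiv1 σ i (a j)) (jetProj (by norm_num) z) := by
  have hz2 : jetProj (Nat.le_succ 2) z ∈ jetSet V 2 := hz
  have hz1 : jetProj (by norm_num : 1 ≤ 3) z ∈ jetSet V 1 := hz
  have hp : ∀ i j, DifferentiableAt ℝ (pderiv1 σ i (a j)) (jetProj (by norm_num : 1 ≤ 3) z) :=
    fun i j => differentiableAt_of_contDiffOn hV (contDiffOn_fderiv_apply hV (ha j) _) hz1
  have hB : DifferentiableAt ℝ (nuCoeff a σ i j) (jetProj (by norm_num : 1 ≤ 3) z) :=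
    differentiableAt_of_contDiffOn hV (contDiffOn_nuCoeff hV ha σ i j) hz1
  have hev : pderiv2 σ i j ell =ᶠ[𝓝 (jetProj (Nat.le_succ 2) z)] fun z =>
      (fun w => 2 * nuCoeff a σ i j w - pderiv1 σ i (a j) w) (jetProj (by norm_num : 1 ≤ 2) z) := by
    filter_upwards [(isOpen_jetSet hV 2).mem_nhds hz2] with y hy
    rw [pderiv2_sub_divergence hV hL ha hell σ i j hy]
    simp only [nuCoeff]
    ring
  have h1 : totalDeriv j (pderiv2 σ i j ell) z = totalDeriv j (fun z =>
      (fun w => 2 * nuCoeff a σ i j w - pderiv1 σ i (a j) w) (jetProj (by norm_num : 1 ≤ 2) z)) z := by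
    rw [totalDeriv, hev.fderiv_eq, totalDeriv]
  have h2 : HasFDerivAt (fun w => 2 * nuCoeff a σ i j w - pderiv1 σ i (a j) w) _
      (jetProj (by norm_num : 1 ≤ 3) z) :=
    (hB.hasFDerivAt.const_mul 2).sub (hp i j).hasFDerivAt
  rw [h1, totalDeriv_comp_jetProj (by norm_num : 1 ≤ 2) h2.differentiableAt]
  exact congrArg (fun A => A (totalVec j (jetProj (by norm_num : 2 ≤ 3) z))) h2.fderiv

theorem Theta2_eq (lam : Form (Jet (n + 1) m 2) (n + 1)) (z : Jet (n + 1) m 3) :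
    Theta2 lam z = contactCombo (r := 1) (lagrangeFun lam (jetProj (by norm_num) z))
      (fun σ i => pderiv1 σ i (lagrangeFun lam) (jetProj (by norm_num) z)
        - ∑ j, totalDeriv j (pderiv2 σ i j (lagrangeFun lam)) z)
      (fun σ i j => pderiv2 σ i j (lagrangeFun lam) (jetProj (by norm_num) z)) z := rfl

/-- The canonical Lepage equivalent on the 2-jet space, in coordinates. -/
def canonicalLepage (lam : Form (Jet (n + 1) m 1) (n + 1)) (a : Fin (n + 1) → Jet (n + 1) m 1 → ℝ) :
    Form (Jet (n + 1) m 2) (n + 1) := fun z =>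
  contactCombo (r := 0) (lagrangeFun lam (jetProj (by norm_num) z))
    (fun σ i => pderiv1 σ i (lagrangeFun lam) (jetProj (by norm_num) z)
      + -2 * ∑ j, totalDeriv j (nuCoeff a σ i j) z)
    (fun σ i j => -2 * nuCoeff a σ i j (jetProj (by norm_num) z)) z

theorem canonicalLepage_eq (hV : IsOpen V) (ha : ∀ i, ContDiffOn ℝ ∞ (a i) (jetSet V 1))
    {z : Jet (n + 1) m 2} (hz : z ∈ jetSet V 2) :
    canonicalLepage lam a z =
      pull (jetProj (by norm_num : 1 ≤ 2)) (Theta1 lam) z + p1 (extDeriv (nuForm a)) z := by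
  rw [p1_extDeriv_nuForm hV ha hz, pull_Theta1 (r := 0), contactCombo_add]
  simp only [canonicalLepage, add_zero, zero_add]

theorem contDiffOn_canonicalLepage (hV : IsOpen V) (hsmooth : ContDiffOn ℝ ∞ lam (jetSet V 1))
    (ha : ∀ i, ContDiffOn ℝ ∞ (a i) (jetSet V 1)) :
    ContDiffOn ℝ ∞ (canonicalLepage lam a) (jetSet V 2) := by
  have hL := contDiffOn_lagrangeFun hsmooth
  refine contDiffOn_contactCombo (contDiffOn_comp_jetProj _ hL) (fun σ i => ?_) fun σ i j => ?_
  · exact (contDiffOn_comp_jetProj _ (contDiffOn_fderiv_apply hV hL _)).add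
      (contDiffOn_const.mul (ContDiffOn.sum fun j _ =>
        contDiffOn_totalDeriv hV (contDiffOn_nuCoeff hV ha σ i j) j))
  · exact contDiffOn_const.mul (contDiffOn_comp_jetProj _ (contDiffOn_nuCoeff hV ha σ i j))

/-- Comparison of coefficients: `∂α^i/∂y^σ` and the total derivatives of `∂α^k/∂y^σ_i` cancel,
leaving the coefficients of `ν`. -/
theorem pull_canonicalLepage (hV : IsOpen V) (hsmooth : ContDiffOn ℝ ∞ lam (jetSet V 1))
    (ha : ∀ i, ContDiffOn ℝ ∞ (a i) (jetSet V 1)) {α : Form (Jet (n + 1) m 1) n}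
    (hα : ∀ z ∈ jetSet V 1, α z = ∑ i, a i z • omega1 i) {lam₂ : Form (Jet (n + 1) m 2) (n + 1)}
    (hlam₂ : ∀ z ∈ jetSet V 2, lagrangeFun lam₂ z =
      lagrangeFun lam (jetProj (by norm_num) z) - ∑ k, totalDeriv k (a k) z)
    {z : Jet (n + 1) m 3} (hz : z ∈ jetSet V 3) :
    pull (jetProj (by norm_num : 2 ≤ 3)) (canonicalLepage lam a) z =
      Theta2 lam₂ z + pull (jetProj (by norm_num : 1 ≤ 3)) (extDeriv α) z := by
  have hL := contDiffOn_lagrangeFun hsmooth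
  have hz2 : jetProj (by norm_num : 2 ≤ 3) z ∈ jetSet V 2 := hz
  have hz1 : jetProj (by norm_num : 1 ≤ 3) z ∈ jetSet V 1 := hz
  -- The coordinate expression of `α` is known only on `V¹`; openness gives it near the point, which
  -- suffices for the exterior derivative.
  have hev : α =ᶠ[𝓝 (jetProj (by norm_num : 1 ≤ 3) z)] fun z => ∑ i, a i z • omega1 i :=
    eventually_of_mem ((isOpen_jetSet hV 1).mem_nhds hz1) hα
  have hdα : pull (jetProj (by norm_num : 1 ≤ 3)) (extDeriv α) z =
      contactCombo (r := 1) (∑ i, totalDeriv i (a i) (jetProj (by norm_num) z))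
        (fun σ i => pderiv0 σ (a i) (jetProj (by norm_num) z))
        (fun σ i j => pderiv1 σ j (a i) (jetProj (by norm_num) z)) z := by
    rw [pull, hev.extDeriv_eq]
    refine Eq.trans ?_ (contactCombo_comp_jetProj (s := 0) (r := 1) (by norm_num) _ _ _ z)
    exact congrArg (fun A => A.compContinuousLinearMap (jetProj (by norm_num : 2 ≤ 3)))
      (pull_extDeriv_sum_omega1 (z := jetProj (by norm_num : 2 ≤ 3) z)
        fun i => differentiableAt_of_contDiffOn hV (ha i) hz1)
  rw [hdα, Theta2_eq, contactCombo_add]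
  refine (contactCombo_comp_jetProj (s := 0) (r := 1) (by norm_num) _ _ _ z).trans ?_
  congr 1
  · rw [hlam₂ _ hz2]
    simp only [sub_add_cancel]
  · funext σ i
    rw [pderiv1_sub_divergence hV hL ha hlam₂ σ i hz2,
      Finset.sum_congr rfl fun j _ => sum_totalDeriv_pderiv2 hV hL ha hlam₂ σ i j hz,
      Finset.sum_sub_distrib, ← Finset.mul_sum]
    have e : jetProj (by norm_num : 1 ≤ 2) (jetProj (by norm_num : 2 ≤ 3) z) =
      jetProj (by norm_num : 1 ≤ 3) z := rfl
    rw [e]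
    ring
  · funext σ i j
    rw [pderiv2_sub_divergence hV hL ha hlam₂ σ i j hz2]
    have e : jetProj (by norm_num : 1 ≤ 2) (jetProj (by norm_num : 2 ≤ 3) z) =
      jetProj (by norm_num : 1 ≤ 3) z := rfl
    rw [e, nuCoeff]
    ring

theorem exists_jetProj_eq (h : 2 ≤ 3) : ∃ g : Jet n m 2 → Jet n m 3, ∀ z, jetProj h (g z) = z := by
  refine ⟨fun z => (z.1, fun σ J => if hJ : J.1.card ≤ 2 then z.2 σ ⟨J.1, hJ⟩ else 0), fun z => ?_⟩
  refine Prod.ext rfl ?_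
  funext σ J
  exact dif_pos J.2

/-- Jets and tangent vectors both lift to order three, by padding with zeros. The lift stays over
`V` because `jetSet` restricts only the coordinates of order zero. -/
theorem pull_jetProj_injective {k : ℕ} (h : 2 ≤ 3) {Φ Ψ : Form (Jet (n + 1) m 2) k}
    (hΦ : ∀ z ∈ jetSet V 3, pull (jetProj h) Φ z = pull (jetProj h) Ψ z)
    {z : Jet (n + 1) m 2} (hz : z ∈ jetSet V 2) : Φ z = Ψ z := by
  obtain ⟨g, hg⟩ := exists_jetProj_eq (n := n + 1) (m := m) h
  have hgz : g z ∈ jetSet V 3 := by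
    have : jetProj h (g z) ∈ jetSet V 2 := by rwa [hg]
    exact this
  have h1 := hΦ _ hgz
  ext v
  have h2 := congrArg (fun A => A fun i => g (v i)) h1
  simp only [pull, ContinuousAlternatingMap.compContinuousLinearMap_apply] at h2
  have h3 : (jetProj h ∘ fun i => g (v i)) = v := funext fun i => hg (v i)
  rwa [h3, hg] at h2

end Canonical

end Lepage
end

/-! ### Assembly of both assertions. -/

theorem mainTheorem5 (n m : ℕ) (V : Set ((Fin (n + 1) → ℝ) × (Fin m → ℝ))) (hV : IsOpen V)
    (hstar : Lepage.VerticallyStarShaped V)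
    (lam : Lepage.Form (Lepage.Jet (n + 1) m 1) (n + 1))
    (hsmooth : ContDiffOn ℝ ∞ lam (Lepage.jetSet V 1)) (hhor : Lepage.IsHorizontal V lam) :
    (∃ μ₀, Lepage.IsBasePrimitive V lam μ₀) ∧
    ∀ μ₀, Lepage.IsBasePrimitive V lam μ₀ →
      ∃ a : Fin (n + 1) → Lepage.Jet (n + 1) m 1 → ℝ,
        (∀ i, ContDiffOn ℝ ∞ (a i) (Lepage.jetSet V 1)) ∧
        (∀ z ∈ Lepage.jetSet V 1,
          Lepage.alphaForm lam μ₀ z = ∑ i, a i z • Lepage.omega1 i) ∧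
        (∀ z ∈ Lepage.jetSet V 2,
          Lepage.pull (Lepage.jetProj (by norm_num : 1 ≤ 2)) lam z =
            Lepage.vainbergTonti lam z + (∑ i, Lepage.totalDeriv i (a i) z) • Lepage.omega0) ∧
        (∃ Φ, Lepage.IsCanonicalLepage V lam μ₀ Φ) ∧
        (∀ Φ, Lepage.IsCanonicalLepage V lam μ₀ Φ → ∀ z ∈ Lepage.jetSet V 2,
          Φ z = Lepage.pull (Lepage.jetProj (by norm_num : 1 ≤ 2)) (Lepage.Theta1 lam) z
            + Lepage.p1 (extDeriv (Lepage.nuForm a)) z) := by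
  refine ⟨Lepage.exists_isBasePrimitive hV hstar hsmooth, fun μ₀ hμ => ?_⟩
  have ha := Lepage.contDiffOn_alphaComp hV hstar hsmooth hμ.1
  have hα := fun z hz => Lepage.alphaForm_eq (μ₀ := μ₀) hV hstar hsmooth (z := z) hz
  have hVT := fun z hz =>
    Lepage.pull_eq_vainbergTonti_add hV hstar hsmooth hhor hμ (z := z) hz
  have hell : ∀ z ∈ Lepage.jetSet V 2, Lepage.lagrangeFun (Lepage.vainbergTonti lam) z =
      Lepage.lagrangeFun lam (Lepage.jetProj (by norm_num) z)
        - ∑ k, Lepage.totalDeriv k (Lepage.alphaComp lam μ₀ k) z := by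
    intro z hz
    -- Evaluation on the coordinate vectors `∂_i`, where `ω_0` takes the value one, turns the
    -- identity of forms into one of Lagrange functions.
    have h1 := congrArg (fun A => A fun i => Lepage.dX i) (hVT z hz)
    simp only [ContinuousAlternatingMap.add_apply, ContinuousAlternatingMap.smul_apply,
      Lepage.omega0_dX, smul_eq_mul, mul_one] at h1
    exact eq_sub_of_add_eq h1.symm
  have hΦ : ∀ z ∈ Lepage.jetSet V 3, _ := fun z hz =>
    Lepage.pull_canonicalLepage hV hsmooth ha hα hell (z := z) hz
  refine ⟨Lepage.alphaComp lam μ₀, ha, hα, hVT,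
    ⟨_, Lepage.contDiffOn_canonicalLepage hV hsmooth ha, hΦ⟩, fun Φ hcan z hz => ?_⟩
  rw [← Lepage.canonicalLepage_eq hV ha hz]
  exact Lepage.pull_jetProj_injective (by norm_num)
    (fun w hw => (hcan.2 w hw).trans (hΦ w hw).symm) hz
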